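/- For a subset $S$ of an analytic set $X\subset\mathbb C^n$, open in $X$, a function on $S$ is holomorphic if it is locally the restriction of a holomorphic function of the ambient space; $\mathcal O_{X,p}$ is the local ring of germs at $p$ of such functions, and $\mathrm{codh}(\mathcal O_{X,p})$ is the maximal length of a regular sequence in its maximal ideal. For compact $K\subset X$ the holomorphically convex hull is $\hat K_X=\{p\in X: |h(p)|\le \sup_K|h| \text{ for all } h\in\mathcal O(X)\}$. (Harvey's example.) Let $f:\mathbb C^2\to\mathbb C^4$, $f(x,y)=(x^2,x^3,y,xy)$, and $X=f(\mathbb C^2)$. 1. $f$ is holomorphic, injective and proper, $f^{-1}(0)=\{0\}$, and the Jacobian of $f$ has rank $1$ at $0$ and rank $2$ everywhere else. $X$ is an irreducible analytic subset of $\mathbb C^4$, is Stein, and is a $2$-dimensional complex submanifold near each point of $X\setminus\{0\}$, while $0$ is a singular point. 2. Let $g$ be the function on $X\setminus\{0\}$ with $g=z_2/z_1$ where $z_1\ne0$ and $g=z_4/z_3$ where $z_3\neq 0$, so that $g(f(x,y))=x$. Then $g$ is well defined and holomorphic on $X\setminus\{0\}$, but for no open neighbourhood $U$ of $0$ does there exist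 a holomorphic function on $X\cap U$ that equals $g$ on $(X\cap U)\setminus\{0\}$. 3. $\mathrm{codh}(\mathcal O_{X,0})=1$. 4. Let $0<\epsilon<1$, let $P(1)=\{|z|<1,|w|<1\}\subset\mathbb C^2$, $T_\epsilon=\{(z,w):(\mathrm{Im}\,z)^2+|w|^2<\epsilon^2\}$, $L=\overline{P(1)}\setminus T_\epsilon$ and $K=f(L)$. Then $K$ is compact, $0\notin K$, $X\setminus K$ is connected and has no irreducible component that is relatively compact in $X$, and $\mathrm{codh}(\mathcal O_{X,p})\ge2$ for all $p\in K$. Nevertheless $0\in\hat K_X$; every Stein neighbourhood of $K$ that is open in $X$ contains $0$; and there is no compact set $C$ with $K\subset C\subset X\setminus\{0\}$ that is holomorphically convex in $X\setminus\{0\}$. Thus, although all hypotheses of the extension theorem in the form "$\mathrm{codh}(\mathcal O_{X,p})\ge 2$ for all $p\in K$" are satisfied, the stronger condition $\mathrm{codh}\ge2$ fails (by part 3) on $\hat K_X$ and on every Stein neighbourhood of $K$. -/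

import Mathlib

open Set Filter Topology

/-! ## Holomorphic functions on subsets of complex vector spaces -/

/-- `h` is holomorphic on `S ⊆ V`: near every point of `S` it is the restriction to `S` of a
function that is holomorphic in the ambient space. For `S` relatively open in an analytic set `X`
these are the sections over `S` of the (reduced) structure sheaf of `X`. Values of `h` outside `S`
play no role. -/
def HolomorphicOnSet {V : Type*} [NormedAddCommGroup V] [NormedSpace ℂ V]
    (S : Set V) (h : V → ℂ) : Prop :=
  ∀ p ∈ S, ∃ F : V → ℂ, AnalyticAt ℂ F p ∧ h =ᶠ[𝓝[S] p] F

/-- The stalk at `p ∈ X` of the reduced structure sheaf of `X`: germs along `X` at `p` of functions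
that are holomorphic in the ambient space near `p`. Two of them are equal when they agree
on `X` near `p`, so this ring is the ring of ambient holomorphic germs modulo the ideal of germs
vanishing on `X`. -/
def analyticStalk {V : Type*} [NormedAddCommGroup V] [NormedSpace ℂ V]
    (X : Set V) (p : X) : Subring (Germ (𝓝[X] (p : V)) ℂ) where
  carrier := {φ | ∃ F : V → ℂ, AnalyticAt ℂ F p ∧ φ = (F : Germ (𝓝[X] (p : V)) ℂ)}
  mul_mem' := by
    rintro _ _ ⟨F, hF, rfl⟩ ⟨G, hG, rfl⟩
    exact ⟨F * G, hF.mul hG, rfl⟩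
  one_mem' := ⟨1, analyticAt_const, rfl⟩
  add_mem' := by
    rintro _ _ ⟨F, hF, rfl⟩ ⟨G, hG, rfl⟩
    exact ⟨F + G, hF.add hG, rfl⟩
  zero_mem' := ⟨0, analyticAt_const, rfl⟩
  neg_mem' := by
    rintro _ ⟨F, hF, rfl⟩
    exact ⟨-F, hF.neg, rfl⟩

theorem analyticStalk_isUnit {V : Type*} [NormedAddCommGroup V] [NormedSpace ℂ V]
    (X : Set V) (p : X) (F : V → ℂ) (hF : AnalyticAt ℂ F p) (h0 : F p ≠ 0)
    (a : analyticStalk X p) (ha : (a : Germ (𝓝[X] (p : V)) ℂ) = F) : IsUnit a := by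
  refine IsUnit.of_mul_eq_one
    (⟨((F⁻¹ : V → ℂ) : Germ (𝓝[X] (p : V)) ℂ), F⁻¹, hF.inv h0, rfl⟩ : analyticStalk X p) ?_
  apply Subtype.ext
  change (a : Germ (𝓝[X] (p : V)) ℂ) * ((F⁻¹ : V → ℂ) : Germ (𝓝[X] (p : V)) ℂ) = 1
  rw [ha]
  refine Germ.coe_eq.2 ?_
  have hne : ∀ᶠ q in 𝓝[X] (p : V), F q ≠ 0 :=
    (hF.continuousAt.eventually_ne h0).filter_mono nhdsWithin_le_nhds
  filter_upwards [hne] with q hq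
  simp [hq]

instance analyticStalk_nontrivial {V : Type*} [NormedAddCommGroup V] [NormedSpace ℂ V]
    (X : Set V) (p : X) : Nontrivial (analyticStalk X p) := by
  have : (𝓝[X] (p : V)).NeBot := mem_closure_iff_nhdsWithin_neBot.1 (subset_closure p.2)
  infer_instance

instance analyticStalk_isLocalRing {V : Type*} [NormedAddCommGroup V] [NormedSpace ℂ V]
    (X : Set V) (p : X) : IsLocalRing (analyticStalk X p) := by
  refine IsLocalRing.of_isUnit_or_isUnit_one_sub_self fun a => ?_
  obtain ⟨F, hF, ha⟩ := a.2
  by_cases h0 : F p = 0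
  · right
    refine analyticStalk_isUnit X p (1 - F) (analyticAt_const.sub hF) (by simp [h0]) _ ?_
    change 1 - (a : Germ (𝓝[X] (p : V)) ℂ) = _
    rw [ha]
    rfl
  · exact Or.inl (analyticStalk_isUnit X p F hF h0 a ha)

/-- The homological codimension (depth) of a module `M` over a local ring `R`: the maximal length
of a sequence `f₁, …, f_q` in the maximal ideal such that each `f_i` is a non-zero-divisor
on `M / (f₁, …, f_{i-1}) M`. -/
noncomputable def codh (R : Type*) [CommRing R] [IsLocalRing R]
    (M : Type*) [AddCommGroup M] [Module R M] : ℕ∞ :=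
  ⨆ (rs : List R) (_ : (∀ r ∈ rs, r ∈ IsLocalRing.maximalIdeal R) ∧
    RingTheory.Sequence.IsWeaklyRegular M rs), (rs.length : ℕ∞)

/-- `codh (𝒪_{X,p})`. -/
noncomputable def stalkCodh {V : Type*} [NormedAddCommGroup V] [NormedSpace ℂ V]
    (X : Set V) (p : X) : ℕ∞ :=
  codh (analyticStalk X p) (analyticStalk X p)

/-- The holomorphically convex hull of `K` in `D`: the points `p ∈ D` with
`|h(p)| ≤ sup_K |h|` for every `h` holomorphic on `D`. -/
def holomorphicHull {V : Type*} [NormedAddCommGroup V] [NormedSpace ℂ V]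
    (D K : Set V) : Set V :=
  {p | p ∈ D ∧ ∀ h : V → ℂ, HolomorphicOnSet D h →
    ∀ M : ℝ, (∀ q ∈ K, ‖h q‖ ≤ M) → ‖h p‖ ≤ M}

/-- The reduced complex space `D` is Stein: it is holomorphically convex and holomorphically
separable. -/
def IsSteinSet {V : Type*} [NormedAddCommGroup V] [NormedSpace ℂ V] (D : Set V) : Prop :=
  (∀ K : Set V, K ⊆ D → IsCompact K → IsCompact (holomorphicHull D K)) ∧
  ∀ p ∈ D, ∀ q ∈ D, p ≠ q → ∃ h : V → ℂ, HolomorphicOnSet D h ∧ h p ≠ h q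

/-- `A` is an analytic subset of `S`: near every point of `S` it is the zero set in `S` of finitely
many holomorphic functions. -/
def IsAnalyticSubset {V : Type*} [NormedAddCommGroup V] [NormedSpace ℂ V]
    (S A : Set V) : Prop :=
  A ⊆ S ∧ ∀ p ∈ S, ∃ U : Set V, IsOpen U ∧ p ∈ U ∧ ∃ (k : ℕ) (F : Fin k → V → ℂ),
    (∀ i, AnalyticOnNhd ℂ (F i) U) ∧ ∀ q ∈ U ∩ S, (q ∈ A ↔ ∀ i, F i q = 0)

/-- `A` is an irreducible analytic subset of `S`. -/
def IsIrreducibleAnalytic {V : Type*} [NormedAddCommGroup V] [NormedSpace ℂ V]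
    (S A : Set V) : Prop :=
  IsAnalyticSubset S A ∧ A.Nonempty ∧ ∀ B C : Set V, IsAnalyticSubset S B →
    IsAnalyticSubset S C → A = B ∪ C → A = B ∨ A = C

/-- `A` is an irreducible component (branch) of `S`. -/
def IsBranch {V : Type*} [NormedAddCommGroup V] [NormedSpace ℂ V] (S A : Set V) : Prop :=
  Maximal (IsIrreducibleAnalytic S) A

/-- `A` is relatively compact in `X`. -/
def IsRelativelyCompactIn {V : Type*} [TopologicalSpace V] (X A : Set V) : Prop :=
  ∃ C : Set V, IsCompact C ∧ C ⊆ X ∧ A ⊆ C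

/-- Near `p`, the set `X ⊆ ℂⁿ` is a complex submanifold of dimension `d`: there are holomorphic
coordinates `w` of `ℂⁿ` near `p` in which `X` is given by `w_{d+1} = … = w_n = 0`. -/
def IsRegularPoint {n : ℕ} (X : Set (Fin n → ℂ)) (d : ℕ) (p : Fin n → ℂ) : Prop :=
  p ∈ X ∧ d ≤ n ∧ ∃ e : OpenPartialHomeomorph (Fin n → ℂ) (Fin n → ℂ), p ∈ e.source ∧
    AnalyticOnNhd ℂ e e.source ∧ AnalyticOnNhd ℂ e.symm e.target ∧
    ∀ q ∈ e.source, (q ∈ X ↔ ∀ i : Fin n, d ≤ (i : ℕ) → e q i = 0)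

/-! ## Harvey's surface -/

/-- `f(x,y) = (x², x³, y, xy)`. -/
def harveyMap (p : Fin 2 → ℂ) : Fin 4 → ℂ := ![p 0 ^ 2, p 0 ^ 3, p 1, p 0 * p 1]

/-- Harvey's surface `X = f(ℂ²)`. -/
def harveySurface : Set (Fin 4 → ℂ) := range harveyMap

theorem zero_mem_harveySurface : (0 : Fin 4 → ℂ) ∈ harveySurface :=
  ⟨0, by ext i; fin_cases i <;> simp [harveyMap]⟩

/-- The origin, as a point of Harvey's surface. -/
def harveyOrigin : harveySurface := ⟨0, zero_mem_harveySurface⟩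

open Classical in
/-- The function `x` on `X ∖ {0}`: it is `z₂/z₁` where `z₁ ≠ 0` and `z₄/z₃` where `z₃ ≠ 0`
(coordinates of `ℂ⁴` are numbered from `1` here and from `0` in the code). -/
noncomputable def harveyFunction (z : Fin 4 → ℂ) : ℂ :=
  if z 0 ≠ 0 then z 1 / z 0 else z 3 / z 2

/-- The open bidisc of radius `r`. -/
def openBidisc (r : ℝ) : Set (Fin 2 → ℂ) := {p | ‖p 0‖ < r ∧ ‖p 1‖ < r}

/-- The open tube `(Im z)² + |w|² < ε²` about `ℝ × {0}` in `ℂ²`. -/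
def openTube (ε : ℝ) : Set (Fin 2 → ℂ) := {p | (p 0).im ^ 2 + ‖p 1‖ ^ 2 < ε ^ 2}

/-- `L`, the closed unit bidisc minus the tube. -/
def harveyL (ε : ℝ) : Set (Fin 2 → ℂ) := closure (openBidisc 1) \ openTube ε

/-- `K = f(L)`. -/
def harveyK (ε : ℝ) : Set (Fin 4 → ℂ) := harveyMap '' harveyL ε

/-! ## Analytic functions of several variables -/

/-! Topologically f is a closed embedding, so a germ along X at f(q) is the same as a germ F ∘ f at
q in ℂ² (`eventually_nhdsWithin_harveySurface`). Away from 0 the local left inverses of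
`exists_analyticAt_leftInverse` make every holomorphic germ in two variables arise this way. At 0
the germ x is missing: f has zero velocity in the x-direction there, so no F ∘ f can agree with x on
the x-axis (`not_eventually_eq_coord`). Multiplication by x nevertheless maps the maximal ideal into
the stalk (`exists_analyticAt_eq_coord_mul`). For germs r ≠ 0 and s in the maximal ideal, s · (xr) =
r · (xs), while xr is not a multiple of r in the stalk; hence no regular sequence has length two.

The statements on K come from the discs {c} × {|w| ≤ 1} with |c| ≤ 1. Their boundaries lie in L, so
the maximum principle puts their images in the hull of K whenever they stay in the domain
(`harveyMap_mem_holomorphicHull`). The disc over c = i lies in L itself, and sliding c down the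
imaginary axis to 0 forces the origin into every Stein neighbourhood (`forall_mem_of_discs`). The
complement of L is connected because the tube leaves the bidisc along the real axis; the identity
theorem then makes X ∖ K irreducible. -/

@[fun_prop]
theorem analyticAt_coord {n : ℕ} (i : Fin n) (p : Fin n → ℂ) :
    AnalyticAt ℂ (fun z : Fin n → ℂ => z i) p :=
  (ContinuousLinearMap.proj (R := ℂ) (φ := fun _ : Fin n => ℂ) i).analyticAt p

/-- Hadamard's lemma for analytic functions. -/
theorem AnalyticAt.exists_eq_add_clm_apply {E F : Type*} [NormedAddCommGroup E] [NormedSpace ℂ E]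
    [NormedAddCommGroup F] [NormedSpace ℂ F] [CompleteSpace F] {f : E → F}
    (hf : AnalyticAt ℂ f 0) :
    ∃ g : E → E →L[ℂ] F, AnalyticAt ℂ g 0 ∧ ∀ᶠ z in 𝓝 0, f z = f 0 + g z z := by
  obtain ⟨p, r, hp⟩ := hf
  have hrad : 0 < p.shift.radius := by
    rw [p.radius_shift]
    exact hp.r_pos.trans_le hp.r_le
  have hs := p.shift.hasFPowerSeriesOnBall hrad
  refine ⟨p.shift.sum, hs.analyticAt, ?_⟩
  -- Putting the constant term back undoes the shift, so p also sums to f 0 + g z z, and uniqueness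
  -- of sums gives the identity.
  have hu : p.shift.unshift (f 0) = p := by
    funext n
    cases n with
    | zero =>
      ext v
      simpa [FormalMultilinearSeries.unshift] using (hp.coeff_zero v).symm
    | succ n =>
      ext v
      simp [FormalMultilinearSeries.unshift, FormalMultilinearSeries.shift]
  have h2 := hs.unshift (z := f 0)
  rw [hu] at h2
  filter_upwards [hp.hasFPowerSeriesAt.eventually_hasSum, h2.hasFPowerSeriesAt.eventually_hasSum]
    with z hz hz'
  have := hz.unique hz'
  simpa using this

/-- Division by y in a single degree: each slot contributes one term when its y-component is split
off. The bound grows only linearly in the degree, so the quotients can be assembled into a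
convergent series. -/
theorem ContinuousMultilinearMap.exists_apply_sub_apply_eq_mul (n : ℕ)
    (f : ContinuousMultilinearMap ℂ (fun _ : Fin (n + 1) => Fin 2 → ℂ) ℂ) :
    ∃ q : ContinuousMultilinearMap ℂ (fun _ : Fin n => Fin 2 → ℂ) ℂ,
      ‖q‖ ≤ (n + 1) * ‖f‖ ∧
      ∀ z : Fin 2 → ℂ, f (fun _ => z) - f (fun _ => ![z 0, 0]) = z 1 * q (fun _ => z) := by
  have he (i : Fin 2) : ‖(Pi.single i 1 : Fin 2 → ℂ)‖ ≤ 1 := by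
    refine (pi_norm_le_iff_of_nonneg zero_le_one).2 fun j => ?_
    by_cases h : j = i <;> simp [h]
  have hdec (z : Fin 2 → ℂ) : z = z 0 • Pi.single 0 1 + z 1 • Pi.single 1 1 := by
    ext i; fin_cases i <;> simp
  have hproj (z : Fin 2 → ℂ) : ![z 0, 0] = z 0 • (Pi.single 0 1 : Fin 2 → ℂ) := by
    ext i; fin_cases i <;> simp
  have hcur {n : ℕ} (f : ContinuousMultilinearMap ℂ (fun _ : Fin (n + 1) => Fin 2 → ℂ) ℂ)
      (i : Fin 2) : ‖f.curryLeft (Pi.single i 1)‖ ≤ ‖f‖ := by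
    refine (f.curryLeft.le_opNorm _).trans ?_
    rw [f.curryLeft_norm]
    exact mul_le_of_le_one_right (norm_nonneg _) (he i)
  have happ {n : ℕ} (f : ContinuousMultilinearMap ℂ (fun _ : Fin (n + 1) => Fin 2 → ℂ) ℂ)
      (w z : Fin 2 → ℂ) : f.curryLeft w (fun _ => z) = f (Fin.cons w (fun _ => z)) := rfl
  have hcons {n : ℕ} (z : Fin 2 → ℂ) :
      (Fin.cons z (fun _ => z) : Fin (n + 1) → Fin 2 → ℂ) = fun _ => z := by
    funext i; refine Fin.cases ?_ (fun j => ?_) i <;> simp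
  induction n with
  | zero =>
    refine ⟨f.curryLeft (Pi.single 1 1), by simpa using hcur f 1, fun z => ?_⟩
    have h1 : f (fun _ => z) = f.curryLeft z (fun _ => z) := by rw [happ, hcons]
    have h2 : f (fun _ => ![z 0, 0]) = f.curryLeft ![z 0, 0] (fun _ => z) := by
      rw [happ]; congr 1; funext i; fin_cases i; simp
    rw [h1, h2, ← sub_apply, ← map_sub]
    have : z - ![z 0, 0] = z 1 • Pi.single 1 1 := by
      ext i; fin_cases i <;> simp
    rw [this, map_smul, smul_apply, smul_eq_mul]
  | succ n ih =>
    obtain ⟨q, hq, hqz⟩ := ih (f.curryLeft (Pi.single 0 1))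
    let Q : (Fin 2 → ℂ) →L[ℂ] ContinuousMultilinearMap ℂ (fun _ : Fin n => Fin 2 → ℂ) ℂ :=
      (ContinuousLinearMap.proj (R := ℂ) (φ := fun _ : Fin 2 => ℂ) 0).smulRight q
    -- Expand the first slot in the basis e₀, e₁. The e₁ part already carries the factor y; the e₀
    -- part is x times a difference of lower degree, divided by induction.
    refine ⟨ContinuousLinearMap.uncurryLeft (Ei := fun _ => Fin 2 → ℂ) Q + f.curryLeft (Pi.single 1 1), ?_, fun z => ?_⟩
    · refine (norm_add_le _ _).trans ?_
      have hQ : ‖Q‖ ≤ ‖q‖ := by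
        refine Q.opNorm_le_bound (norm_nonneg _) fun z => ?_
        change ‖z 0 • q‖ ≤ _
        rw [norm_smul, mul_comm]
        gcongr
        exact norm_le_pi_norm z 0
      have hQ' : ‖ContinuousLinearMap.uncurryLeft (Ei := fun _ => Fin 2 → ℂ) Q‖ ≤ ‖q‖ := by
        rw [ContinuousLinearMap.uncurryLeft_norm]; exact hQ
      have h0 := hcur f 0
      have h1 := hcur f 1
      have : ((n : ℝ) + 1) * ‖f.curryLeft (Pi.single 0 1)‖ ≤ (n + 1) * ‖f‖ := by gcongr
      push_cast
      linarith
    · have h1 : f (fun _ => z) = z 0 * f.curryLeft (Pi.single 0 1) (fun _ => z) +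
          z 1 * f.curryLeft (Pi.single 1 1) (fun _ => z) := by
        have : f (fun _ => z) = f.curryLeft z (fun _ => z) := by rw [happ, hcons]
        rw [this]
        conv_lhs => rw [show f.curryLeft z = z 0 • f.curryLeft (Pi.single 0 1) +
          z 1 • f.curryLeft (Pi.single 1 1) by rw [← map_smul, ← map_smul, ← map_add, ← hdec]]
        simp
      have h2 : f (fun _ => ![z 0, 0]) =
          z 0 * f.curryLeft (Pi.single 0 1) (fun _ => ![z 0, 0]) := by
        have : f (fun _ => ![z 0, 0]) = f.curryLeft ![z 0, 0] (fun _ => ![z 0, 0]) := by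
          rw [happ, hcons]
        rw [this]
        conv_lhs => rw [show f.curryLeft ![z 0, 0] = z 0 • f.curryLeft (Pi.single 0 1) by
          rw [← map_smul, ← hproj]]
        simp
      have h3 : ContinuousLinearMap.uncurryLeft (Ei := fun _ => Fin 2 → ℂ) Q (fun _ => z) = z 0 * q (fun _ => z) := rfl
      rw [h1, h2, add_apply, h3]
      linear_combination z 0 * hqz z

/-- An analytic germ in two variables that vanishes for `y = 0` is divisible by `y`. -/
theorem AnalyticAt.exists_eq_mul_of_eventually_eq_zero {A : (Fin 2 → ℂ) → ℂ}
    (hA : AnalyticAt ℂ A 0) (h0 : ∀ᶠ z : Fin 2 → ℂ in 𝓝 0, A ![z 0, 0] = 0) :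
    ∃ C : (Fin 2 → ℂ) → ℂ, AnalyticAt ℂ C 0 ∧ ∀ᶠ z in 𝓝 0, A z = z 1 * C z := by
  obtain ⟨p, R, hp⟩ := hA
  choose q hq hqz using fun n =>
    ContinuousMultilinearMap.exists_apply_sub_apply_eq_mul n (p (n + 1))
  let Q : FormalMultilinearSeries ℂ (Fin 2 → ℂ) ℂ := q
  have hrad : 0 < Q.radius := by
    obtain ⟨r, hr0, hr⟩ := ENNReal.lt_iff_exists_nnreal_btwn.1 (hp.r_pos.trans_le hp.r_le)
    have hr0' : 0 < r := by exact_mod_cast hr0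
    obtain ⟨c, hc, hpc⟩ := p.norm_mul_pow_le_of_lt_radius hr
    -- Halving the radius absorbs the factor n + 1 ≤ 2 ^ n.
    have : ((r / 2 : NNReal) : ENNReal) ≤ Q.radius := by
      refine Q.le_radius_of_bound (c / r) fun n => ?_
      have h1 : (n + 1 : ℝ) ≤ 2 ^ n := by exact_mod_cast Nat.lt_two_pow_self (n := n)
      have hrpos : (0 : ℝ) < r := hr0'
      calc ‖Q n‖ * ((r / 2 : NNReal) : ℝ) ^ n
          ≤ ((n + 1) * ‖p (n + 1)‖) * ((r / 2 : NNReal) : ℝ) ^ n := by gcongr; exact hq n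
        _ ≤ (2 ^ n * ‖p (n + 1)‖) * ((r / 2 : NNReal) : ℝ) ^ n := by gcongr
        _ = ‖p (n + 1)‖ * r ^ (n + 1) / r := by
          push_cast
          rw [div_pow]
          field_simp
          ring
        _ ≤ c / r := by gcongr; exact hpc _
    refine lt_of_lt_of_le ?_ this
    exact_mod_cast half_pos hr0'
  have hQ := Q.hasFPowerSeriesOnBall hrad
  refine ⟨Q.sum, hQ.analyticAt, ?_⟩
  have hP : Tendsto (fun z : Fin 2 → ℂ => (![z 0, 0] : Fin 2 → ℂ)) (𝓝 0) (𝓝 0) := by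
    have : Continuous fun z : Fin 2 → ℂ => (![z 0, 0] : Fin 2 → ℂ) := by
      refine continuous_pi fun i => ?_
      fin_cases i <;> simp <;> fun_prop
    refine this.tendsto' _ _ ?_
    ext i; fin_cases i <;> simp
  have hs := hp.hasFPowerSeriesAt.eventually_hasSum
  filter_upwards [hs, hP.eventually hs, hQ.hasFPowerSeriesAt.eventually_hasSum, h0]
    with z h1 h2 h3 h4
  simp only [zero_add] at h1 h2 h3
  have h5 := h1.sub h2
  rw [h4, sub_zero] at h5
  have h6 := (hasSum_nat_add_iff' 1).2 h5
  have h7 : (fun n => p (n + 1) (fun _ => z) - p (n + 1) (fun _ => ![z 0, 0])) =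
      fun n => z 1 * Q n (fun _ => z) := funext fun n => hqz n z
  rw [h7] at h6
  have h8 : p 0 (fun _ => z) = p 0 (fun _ => ![z 0, 0]) := by
    congr 1; funext i; exact i.elim0
  have h9 := h6.unique (h3.mul_left (z 1))
  simpa [h8] using h9

/-! ## The parametrization of Harvey's surface -/

@[simp] theorem harveyMap_apply_zero (p : Fin 2 → ℂ) : harveyMap p 0 = p 0 ^ 2 := rfl
@[simp] theorem harveyMap_apply_one (p : Fin 2 → ℂ) : harveyMap p 1 = p 0 ^ 3 := rfl
@[simp] theorem harveyMap_apply_two (p : Fin 2 → ℂ) : harveyMap p 2 = p 1 := rfl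
@[simp] theorem harveyMap_apply_three (p : Fin 2 → ℂ) : harveyMap p 3 = p 0 * p 1 := rfl

theorem harveyMap_injective : Function.Injective harveyMap := by
  intro p q h
  have h0 : p 0 ^ 2 = q 0 ^ 2 := congrFun h 0
  have h1 : p 0 ^ 3 = q 0 ^ 3 := congrFun h 1
  have h2 : p 1 = q 1 := congrFun h 2
  have h3 : p 0 = q 0 := by
    by_cases hq : q 0 = 0
    · rw [hq] at h0 ⊢
      simpa using h0
    · have : q 0 ^ 2 * (p 0 - q 0) = 0 := by linear_combination h1 - p 0 * h0
      have := (mul_eq_zero.1 this).resolve_left (pow_ne_zero 2 hq)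
      exact sub_eq_zero.1 this
  ext i; fin_cases i
  exacts [h3, h2]

theorem harveyMap_zero : harveyMap 0 = 0 := by
  ext i; fin_cases i <;> simp [harveyMap]

theorem harveyMap_eq_zero_iff {p : Fin 2 → ℂ} : harveyMap p = 0 ↔ p = 0 := by
  rw [← harveyMap_zero, harveyMap_injective.eq_iff]

theorem ne_zero_iff_fin_two {p : Fin 2 → ℂ} : p ≠ 0 ↔ p 0 ≠ 0 ∨ p 1 ≠ 0 := by
  rw [Function.ne_iff, Fin.exists_fin_two]; rfl

@[fun_prop]
theorem harveyMap_analyticAt (p : Fin 2 → ℂ) : AnalyticAt ℂ harveyMap p := by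
  refine (analyticAt_pi_iff (f := fun i p => harveyMap p i)).2 fun i => ?_
  fin_cases i
  · exact (analyticAt_coord 0 p).pow 2
  · exact (analyticAt_coord 0 p).pow 3
  · exact analyticAt_coord 1 p
  · exact (analyticAt_coord 0 p).mul (analyticAt_coord 1 p)

theorem continuous_harveyMap : Continuous harveyMap :=
  continuous_iff_continuousAt.2 fun p => (harveyMap_analyticAt p).continuousAt

theorem isProperMap_harveyMap : IsProperMap harveyMap := by
  refine isProperMap_iff_tendsto_cocompact.2 ⟨continuous_harveyMap, ?_⟩
  rw [← Metric.cobounded_eq_cocompact, ← Metric.cobounded_eq_cocompact,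
    ← tendsto_norm_atTop_iff_cobounded]
  refine tendsto_atTop_mono (f := fun p : Fin 2 → ℂ => ‖p‖ + (-1)) (fun p => ?_)
    (tendsto_atTop_add_const_right _ _ tendsto_norm_cobounded_atTop)
  -- y is a coordinate of f, and |x| ≤ |x|² + 1 controls the other variable.
  have h : ‖p‖ ≤ ‖harveyMap p‖ + 1 := by
    refine (pi_norm_le_iff_of_nonneg (by positivity)).2 fun i => ?_
    fin_cases i
    · have := norm_le_pi_norm (harveyMap p) 0
      rw [harveyMap_apply_zero, norm_pow] at this
      simp only [Fin.zero_eta]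
      nlinarith [sq_nonneg (‖p 0‖ - 1)]
    · have := norm_le_pi_norm (harveyMap p) 2
      rw [harveyMap_apply_two] at this
      simp only [Fin.mk_one]
      linarith
  linarith

theorem isClosedEmbedding_harveyMap : IsClosedEmbedding harveyMap :=
  .of_continuous_injective_isClosedMap continuous_harveyMap harveyMap_injective
    isProperMap_harveyMap.isClosedMap

/-- Holds at the origin too, where f is not an immersion: only the topology matters. It turns every
question about germs along X into one about germs on ℂ². -/
theorem map_harveyMap_nhds (q : Fin 2 → ℂ) :
    map harveyMap (𝓝 q) = 𝓝[harveySurface] (harveyMap q) :=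
  isClosedEmbedding_harveyMap.isEmbedding.map_nhds_eq q

theorem eventually_nhdsWithin_harveySurface {q : Fin 2 → ℂ} {P : (Fin 4 → ℂ) → Prop} :
    (∀ᶠ z in 𝓝[harveySurface] (harveyMap q), P z) ↔ ∀ᶠ p in 𝓝 q, P (harveyMap p) := by
  rw [← map_harveyMap_nhds, eventually_map]

theorem fderiv_harveyMap_apply (p v : Fin 2 → ℂ) :
    fderiv ℂ harveyMap p v = ![2 * p 0 * v 0, 3 * p 0 ^ 2 * v 0, v 1, p 0 * v 1 + p 1 * v 0] := by
  have h (i : Fin 2) : HasFDerivAt (fun p : Fin 2 → ℂ => p i)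
      (ContinuousLinearMap.proj (R := ℂ) (φ := fun _ : Fin 2 => ℂ) i) p :=
    (ContinuousLinearMap.proj (R := ℂ) (φ := fun _ : Fin 2 => ℂ) i).hasFDerivAt
  have hd := (harveyMap_analyticAt p).differentiableAt.hasFDerivAt
  rw [hasFDerivAt_pi'] at hd
  ext i
  change (ContinuousLinearMap.proj (R := ℂ) (φ := fun _ : Fin 4 => ℂ) i).comp
    (fderiv ℂ harveyMap p) v = _
  fin_cases i
  · exact (DFunLike.congr_fun ((hd 0).unique ((h 0).pow 2)) v).trans (by simp)
  · exact (DFunLike.congr_fun ((hd 1).unique ((h 0).pow 3)) v).trans (by simp)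
  · exact (DFunLike.congr_fun ((hd 2).unique (h 1)) v).trans (by simp)
  · exact (DFunLike.congr_fun ((hd 3).unique ((h 0).mul (h 1))) v).trans (by simp)

theorem fderiv_harveyMap_injective {p : Fin 2 → ℂ} (hp : p ≠ 0) :
    Function.Injective (fderiv ℂ harveyMap p) := by
  refine (injective_iff_map_eq_zero _).2 fun v hv => ?_
  rw [fderiv_harveyMap_apply] at hv
  have h0 : 2 * p 0 * v 0 = 0 := congrFun hv 0
  have h2 : v 1 = 0 := congrFun hv 2
  have h3 : p 0 * v 1 + p 1 * v 0 = 0 := congrFun hv 3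
  have : v 0 = 0 := by
    rcases ne_zero_iff_fin_two.1 hp with h | h
    · simpa [h] using h0
    · simpa [h, h2] using h3
  ext i; fin_cases i
  exacts [this, h2]

theorem rank_fderiv_harveyMap_of_ne_zero {p : Fin 2 → ℂ} (hp : p ≠ 0) :
    (fderiv ℂ harveyMap p).rank = 2 := by
  rw [LinearMap.rank, rank_range_of_injective _ (fderiv_harveyMap_injective hp)]
  simp

theorem rank_fderiv_harveyMap_zero : (fderiv ℂ harveyMap 0).rank = 1 := by
  have : LinearMap.range (fderiv ℂ harveyMap 0 : (Fin 2 → ℂ) →ₗ[ℂ] Fin 4 → ℂ) =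
      Submodule.span ℂ {(Pi.single 2 1 : Fin 4 → ℂ)} := by
    ext z
    rw [LinearMap.mem_range, Submodule.mem_span_singleton]
    constructor
    · rintro ⟨v, rfl⟩
      refine ⟨v 1, ?_⟩
      rw [ContinuousLinearMap.coe_coe, fderiv_harveyMap_apply]
      ext i; fin_cases i <;> simp
    · rintro ⟨a, rfl⟩
      refine ⟨![0, a], ?_⟩
      rw [ContinuousLinearMap.coe_coe, fderiv_harveyMap_apply]
      ext i; fin_cases i <;> simp
  rw [LinearMap.rank, this, ← Module.finrank_eq_rank, finrank_span_singleton, Nat.cast_one]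
  intro h
  simpa using congrFun h 2

/-! ## Harvey's surface as an analytic set -/

/-- Where `z 0 ≠ 0` one recovers x as `z 1 / z 0`, and the first two equations suffice. Where `z 0 =
0` the second becomes vacuous, and the third is what forces `z 3 = 0`. -/
theorem mem_harveySurface_iff {z : Fin 4 → ℂ} : z ∈ harveySurface ↔
    z 1 ^ 2 = z 0 ^ 3 ∧ z 0 * z 3 = z 1 * z 2 ∧ z 3 ^ 2 = z 0 * z 2 ^ 2 := by
  constructor
  · rintro ⟨p, rfl⟩
    refine ⟨?_, ?_, ?_⟩ <;> simp <;> ring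
  · rintro ⟨h1, h2, h3⟩
    by_cases h0 : z 0 = 0
    · have h1' : z 1 = 0 := by simpa [h0] using h1
      have h3' : z 3 = 0 := by simpa [h0] using h3
      refine ⟨![0, z 2], ?_⟩
      ext i; fin_cases i <;> simp [harveyMap, h0, h1', h3']
    · refine ⟨![z 1 / z 0, z 2], ?_⟩
      ext i; fin_cases i <;> simp [harveyMap] <;> field_simp
      · linear_combination h1
      · linear_combination z 1 * h1
      · linear_combination - h2

theorem isAnalyticSubset_harveySurface : IsAnalyticSubset univ harveySurface := by
  refine ⟨subset_univ _, fun p _ => ⟨univ, isOpen_univ, mem_univ _, 3,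
    ![fun z => z 1 ^ 2 - z 0 ^ 3, fun z => z 0 * z 3 - z 1 * z 2,
      fun z => z 3 ^ 2 - z 0 * z 2 ^ 2], ?_, fun q _ => ?_⟩⟩
  · intro i q _
    have h (i : Fin 4) := analyticAt_coord i q
    fin_cases i
    · exact ((h 1).pow 2).sub ((h 0).pow 3)
    · exact ((h 0).mul (h 3)).sub ((h 1).mul (h 2))
    · exact ((h 3).pow 2).sub ((h 0).mul ((h 2).pow 2))
  · rw [mem_harveySurface_iff, Fin.forall_fin_succ, Fin.forall_fin_two]
    simp [sub_eq_zero]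

theorem isClosed_harveySurface : IsClosed harveySurface :=
  isClosedEmbedding_harveyMap.isClosed_range

/-! ## The function `x` on the regular part -/

theorem harveyFunction_harveyMap (p : Fin 2 → ℂ) :
    harveyFunction (harveyMap p) = p 0 := by
  unfold harveyFunction
  by_cases h : p 0 = 0
  -- The fallback branch gives 0 / y = 0; at the origin this is the convention 0 / 0 = 0.
  · simp [h]
  · rw [if_pos (show harveyMap p 0 ≠ 0 from pow_ne_zero 2 h), harveyMap_apply_zero, harveyMap_apply_one]
    field_simp

theorem harveyFunction_eq_of_ne_zero {z : Fin 4 → ℂ} (hz : z ∈ harveySurface) (h2 : z 2 ≠ 0) :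
    harveyFunction z = z 3 / z 2 := by
  obtain ⟨p, rfl⟩ := hz
  have hp : p ≠ 0 := ne_zero_iff_fin_two.2 (Or.inr h2)
  rw [harveyFunction_harveyMap]
  simp only [harveyMap_apply_two] at h2
  simp [h2]

/-- Away from `0` the parametrization has local holomorphic left inverses in the ambient space. -/
theorem exists_analyticAt_leftInverse {q : Fin 2 → ℂ} (hq : q ≠ 0) :
    ∃ ψ : (Fin 4 → ℂ) → Fin 2 → ℂ, AnalyticAt ℂ ψ (harveyMap q) ∧
      ∀ᶠ p in 𝓝 q, ψ (harveyMap p) = p := by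
  have key (i j : Fin 4) (hi : harveyMap q i ≠ 0)
      (hij : ∀ p, harveyMap p i ≠ 0 → harveyMap p j / harveyMap p i = p 0) :
      ∃ ψ : (Fin 4 → ℂ) → Fin 2 → ℂ, AnalyticAt ℂ ψ (harveyMap q) ∧
        ∀ᶠ p in 𝓝 q, ψ (harveyMap p) = p := by
    refine ⟨fun z => ![z j / z i, z 2], ?_, ?_⟩
    · refine (analyticAt_pi_iff
        (f := fun k (z : Fin 4 → ℂ) => (![z j / z i, z 2] : Fin 2 → ℂ) k)).2 fun k => ?_
      fin_cases k
      · exact (analyticAt_coord j _).div (analyticAt_coord i _) hi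
      · exact analyticAt_coord 2 _
    · have hc : Continuous fun p => harveyMap p i := (continuous_apply i).comp continuous_harveyMap
      filter_upwards [hc.continuousAt.eventually_ne hi] with p hp
      ext k; fin_cases k
      · exact hij p hp
      · rfl
  rcases ne_zero_iff_fin_two.1 hq with h | h
  · refine key 0 1 (pow_ne_zero 2 h) fun p hp => ?_
    have : p 0 ≠ 0 := fun h => hp (by simp [h])
    simp only [harveyMap_apply_zero, harveyMap_apply_one]
    field_simp
  · refine key 2 3 h fun p hp => ?_
    simp only [harveyMap_apply_two, harveyMap_apply_three] at hp ⊢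
    field_simp

theorem holomorphicOnSet_harveyFunction :
    HolomorphicOnSet (harveySurface \ {0}) harveyFunction := by
  rintro _ ⟨⟨q, rfl⟩, hq⟩
  have hq0 : q ≠ 0 := fun h => hq (by simp [h, harveyMap_zero])
  obtain ⟨ψ, hψ, hψq⟩ := exists_analyticAt_leftInverse hq0
  refine ⟨fun z => ψ z 0, (analyticAt_pi_iff (f := fun i z => ψ z i)).1 hψ 0, ?_⟩
  refine Filter.Eventually.filter_mono (nhdsWithin_mono _ sdiff_subset) ?_
  rw [eventually_nhdsWithin_harveySurface]
  filter_upwards [hψq, eventually_ne_nhds hq0] with p hp hp0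
  rw [harveyFunction_harveyMap, hp]

/-- The curve (x², x³, 0, 0) has zero velocity at 0, so F along it has derivative 0, whereas x has
derivative 1. The punctured neighbourhood suits extensions that are prescribed only off the origin.
-/
theorem not_eventually_eq_coord {F : (Fin 4 → ℂ) → ℂ} (hF : AnalyticAt ℂ F 0) :
    ¬ ∀ᶠ x : ℂ in 𝓝[≠] 0, F (harveyMap ![x, 0]) = x := by
  intro h
  rw [← harveyMap_zero] at hF
  have h1 : HasDerivAt (fun x : ℂ => (![x, 0] : Fin 2 → ℂ)) ![1, 0] 0 := by
    rw [hasDerivAt_pi]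
    intro i; fin_cases i
    · exact hasDerivAt_id' _
    · exact hasDerivAt_const _ _
  have h0 : (![(0 : ℂ), 0] : Fin 2 → ℂ) = 0 := by ext i; fin_cases i <;> rfl
  have h2 : HasDerivAt (fun x : ℂ => harveyMap ![x, 0]) (fderiv ℂ harveyMap 0 ![1, 0]) 0 := by
    have := (harveyMap_analyticAt 0).differentiableAt.hasFDerivAt
    rw [← h0] at this
    have h3 := this.comp_hasDerivAt (0 : ℂ) h1
    rw [h0] at h3
    exact h3
  have h3 : HasDerivAt (fun x : ℂ => F (harveyMap ![x, 0])) 0 0 := by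
    have := hF.differentiableAt.hasFDerivAt
    rw [← h0] at this
    have h4 := this.comp_hasDerivAt (0 : ℂ) h2
    have h5 : fderiv ℂ harveyMap 0 ![1, 0] = 0 := by
      rw [fderiv_harveyMap_apply]; ext i; fin_cases i <;> simp
    rw [h5, map_zero] at h4
    exact h4
  have hF0 : F (harveyMap ![(0 : ℂ), 0]) = 0 := by
    refine tendsto_nhds_unique (l := 𝓝[≠] (0 : ℂ)) (h3.continuousAt.tendsto.mono_left nhdsWithin_le_nhds)
      (Tendsto.congr' (f₁ := fun x : ℂ => x) ?_ (tendsto_id.mono_left nhdsWithin_le_nhds))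
    filter_upwards [h] with x hx using hx.symm
  have h6 : (fun x : ℂ => F (harveyMap ![x, 0])) =ᶠ[𝓝 0] fun x => x := by
    rw [eventually_nhdsWithin_iff] at h
    filter_upwards [h] with x hx
    by_cases hx0 : x = 0
    · rw [hx0, hF0]
    · exact hx hx0
  have := (h3.congr_of_eventuallyEq h6.symm).unique (hasDerivAt_id' _)
  exact zero_ne_one this

theorem harveyFunction_not_extends {U : Set (Fin 4 → ℂ)} (hU : IsOpen U) (h0 : 0 ∈ U) :
    ¬ ∃ G : (Fin 4 → ℂ) → ℂ, HolomorphicOnSet (harveySurface ∩ U) G ∧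
      EqOn G harveyFunction ((harveySurface ∩ U) \ {0}) := by
  rintro ⟨G, hG, hGe⟩
  obtain ⟨F, hF, hGF⟩ := hG 0 ⟨zero_mem_harveySurface, h0⟩
  refine not_eventually_eq_coord hF ?_
  rw [inter_comm, nhdsWithin_inter_of_mem (mem_nhdsWithin_of_mem_nhds (hU.mem_nhds h0))] at hGF
  have hGF' := hGF
  rw [← harveyMap_zero] at hGF'
  have hU' : ∀ᶠ p in 𝓝 (0 : Fin 2 → ℂ), harveyMap p ∈ U :=
    continuous_harveyMap.continuousAt.eventually_mem (by rw [harveyMap_zero]; exact hU.mem_nhds h0)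
  have hc : Tendsto (fun x : ℂ => (![x, 0] : Fin 2 → ℂ)) (𝓝 0) (𝓝 0) := by
    have : Continuous fun x : ℂ => (![x, 0] : Fin 2 → ℂ) := by
      refine continuous_pi fun i => ?_
      fin_cases i <;> simp <;> fun_prop
    refine this.tendsto' _ _ ?_
    ext i; fin_cases i <;> simp
  have h1 := hc.eventually ((eventually_nhdsWithin_harveySurface.1 hGF').and hU')
  filter_upwards [nhdsWithin_le_nhds h1, self_mem_nhdsWithin] with x hx hx0
  have hp : (![x, 0] : Fin 2 → ℂ) ≠ 0 := ne_zero_iff_fin_two.2 (Or.inl hx0)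
  rw [← hx.1, hGe ⟨⟨mem_range_self _, hx.2⟩, by simpa [harveyMap_eq_zero_iff] using hp⟩,
    harveyFunction_harveyMap]
  rfl

/-! ## Regular points -/

theorem analyticAt_vecCons₄ {E : Type*} [NormedAddCommGroup E] [NormedSpace ℂ E]
    {a b c d : E → ℂ} {p : E} (ha : AnalyticAt ℂ a p) (hb : AnalyticAt ℂ b p)
    (hc : AnalyticAt ℂ c p) (hd : AnalyticAt ℂ d p) :
    AnalyticAt ℂ (fun z => ![a z, b z, c z, d z]) p := by
  refine (analyticAt_pi_iff (f := fun k z => (![a z, b z, c z, d z] : Fin 4 → ℂ) k)).2 fun k => ?_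
  fin_cases k
  exacts [ha, hb, hc, hd]

/-- The coordinates that straighten Harvey's surface where `z₁ ≠ 0`. -/
noncomputable def harveyChartFst : OpenPartialHomeomorph (Fin 4 → ℂ) (Fin 4 → ℂ) where
  -- The first two entries are the parameters x and y; the last two measure the failure of `z 0 = x
  -- ^ 2` and `z 3 = x * y`.
  toFun z := ![z 1 / z 0, z 2, z 0 - (z 1 / z 0) ^ 2, z 3 - z 1 / z 0 * z 2]
  invFun w := ![w 2 + w 0 ^ 2, w 0 * (w 2 + w 0 ^ 2), w 1, w 3 + w 0 * w 1]
  source := {z | z 0 ≠ 0}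
  target := {w | w 2 + w 0 ^ 2 ≠ 0}
  map_source' z hz := by simpa using hz
  map_target' w hw := by simpa using hw
  left_inv' z hz := by
    have hz : z 0 ≠ 0 := hz
    ext i; fin_cases i <;> simp
    field_simp
  right_inv' w hw := by
    have hw : w 2 + w 0 ^ 2 ≠ 0 := hw
    ext i; fin_cases i <;> simp <;> field_simp <;> ring
  open_source := isOpen_ne_fun (continuous_apply 0) continuous_const
  open_target := isOpen_ne_fun (by fun_prop) continuous_const
  continuousOn_toFun z hz := by
    have h (i : Fin 4) := analyticAt_coord i z
    have h10 := (h 1).div (h 0) hz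
    exact (analyticAt_vecCons₄ h10 (h 2) ((h 0).sub (h10.pow 2))
      ((h 3).sub (h10.mul (h 2)))).continuousAt.continuousWithinAt
  continuousOn_invFun w _ := by
    have h (i : Fin 4) := analyticAt_coord i w
    have h20 := (h 2).add ((h 0).pow 2)
    exact (analyticAt_vecCons₄ h20 ((h 0).mul h20) (h 1)
      ((h 3).add ((h 0).mul (h 1)))).continuousAt.continuousWithinAt

/-- The coordinates that straighten Harvey's surface where `z₃ ≠ 0`. -/
noncomputable def harveyChartSnd : OpenPartialHomeomorph (Fin 4 → ℂ) (Fin 4 → ℂ) where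
  toFun z := ![z 3 / z 2, z 2, z 0 - (z 3 / z 2) ^ 2, z 1 - (z 3 / z 2) ^ 3]
  invFun w := ![w 2 + w 0 ^ 2, w 3 + w 0 ^ 3, w 1, w 0 * w 1]
  source := {z | z 2 ≠ 0}
  target := {w | w 1 ≠ 0}
  map_source' z hz := by simpa using hz
  map_target' w hw := by simpa using hw
  left_inv' z hz := by
    have hz : z 2 ≠ 0 := hz
    ext i; fin_cases i <;> simp
    field_simp
  right_inv' w hw := by
    have hw : w 1 ≠ 0 := hw
    ext i; fin_cases i <;> simp <;> field_simp <;> ring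
  open_source := isOpen_ne_fun (continuous_apply 2) continuous_const
  open_target := isOpen_ne_fun (continuous_apply 1) continuous_const
  continuousOn_toFun z hz := by
    have h (i : Fin 4) := analyticAt_coord i z
    have h32 := (h 3).div (h 2) hz
    exact (analyticAt_vecCons₄ h32 (h 2) ((h 0).sub (h32.pow 2))
      ((h 1).sub (h32.pow 3))).continuousAt.continuousWithinAt
  continuousOn_invFun w _ := by
    have h (i : Fin 4) := analyticAt_coord i w
    exact (analyticAt_vecCons₄ ((h 2).add ((h 0).pow 2)) ((h 3).add ((h 0).pow 3)) (h 1)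
      ((h 0).mul (h 1))).continuousAt.continuousWithinAt

theorem isRegularPoint_harveySurface {p : Fin 4 → ℂ} (hp : p ∈ harveySurface \ {0}) :
    IsRegularPoint harveySurface 2 p := by
  have hall (e : Fin 4 → ℂ) : (∀ i : Fin 4, 2 ≤ (i : ℕ) → e i = 0) ↔ e 2 = 0 ∧ e 3 = 0 := by
    simp [Fin.forall_fin_succ]
  refine ⟨hp.1, by norm_num, ?_⟩
  obtain ⟨⟨q, rfl⟩, hq⟩ := hp
  have hq0 : q ≠ 0 := fun h => hq (by simp [h, harveyMap_zero])
  rcases ne_zero_iff_fin_two.1 hq0 with h | h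
  · refine ⟨harveyChartFst, pow_ne_zero 2 h, fun z hz => ?_, fun w _ => ?_, fun z hz => ?_⟩
    · have h (i : Fin 4) := analyticAt_coord i z
      have h10 := (h 1).div (h 0) hz
      exact analyticAt_vecCons₄ h10 (h 2) ((h 0).sub (h10.pow 2)) ((h 3).sub (h10.mul (h 2)))
    · have h (i : Fin 4) := analyticAt_coord i w
      have h20 := (h 2).add ((h 0).pow 2)
      exact analyticAt_vecCons₄ h20 ((h 0).mul h20) (h 1) ((h 3).add ((h 0).mul (h 1)))
    · have hz : z 0 ≠ 0 := hz
      rw [hall, mem_harveySurface_iff]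
      change _ ↔ z 0 - (z 1 / z 0) ^ 2 = 0 ∧ z 3 - z 1 / z 0 * z 2 = 0
      constructor
      · rintro ⟨h1, h2, -⟩
        constructor
        · field_simp
          linear_combination -h1
        · field_simp
          linear_combination h2
      · rintro ⟨h1, h2⟩
        have h3 : z 0 = (z 1 / z 0) ^ 2 := sub_eq_zero.1 h1
        have h4 : z 3 = z 1 / z 0 * z 2 := sub_eq_zero.1 h2
        set t := z 1 / z 0 with ht
        have h5 : z 1 = t * z 0 := by rw [ht]; field_simp
        refine ⟨?_, ?_, ?_⟩
        · rw [h5, h3]; ring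
        · rw [h5, h4]; ring
        · rw [h4, h3]; ring
  · refine ⟨harveyChartSnd, h, fun z hz => ?_, fun w _ => ?_, fun z hz => ?_⟩
    · have h (i : Fin 4) := analyticAt_coord i z
      have h32 := (h 3).div (h 2) hz
      exact analyticAt_vecCons₄ h32 (h 2) ((h 0).sub (h32.pow 2)) ((h 1).sub (h32.pow 3))
    · have h (i : Fin 4) := analyticAt_coord i w
      exact analyticAt_vecCons₄ ((h 2).add ((h 0).pow 2)) ((h 3).add ((h 0).pow 3)) (h 1)
        ((h 0).mul (h 1))
    · have hz : z 2 ≠ 0 := hz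
      rw [hall]
      change _ ↔ z 0 - (z 3 / z 2) ^ 2 = 0 ∧ z 1 - (z 3 / z 2) ^ 3 = 0
      constructor
      · rintro ⟨q, rfl⟩
        simp only [harveyMap_apply_two] at hz
        simp [hz]
      · rintro ⟨h1, h2⟩
        refine ⟨![z 3 / z 2, z 2], ?_⟩
        ext i; fin_cases i <;> simp [harveyMap]
        · exact (sub_eq_zero.1 h1).symm
        · exact (sub_eq_zero.1 h2).symm
        · field_simp

/-! ### The singular point at the origin -/

theorem two_le_analyticOrderAt_iff_deriv_eq_zero {g : ℂ → ℂ} {t : ℂ} (hg : AnalyticAt ℂ g t)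
    (h0 : g t = 0) : 2 ≤ analyticOrderAt g t ↔ deriv g t = 0 := by
  have h := analyticOrderAt_deriv_ge_iff hg h0 (n := 1)
  have h2 : (2 : ℕ∞) = ((1 + 1 : ℕ) : ℕ∞) := by norm_num
  rw [h2, ← Nat.cast_add_one] at *
  rw [← h, Nat.cast_one, Order.one_le_iff_ne_zero, hg.deriv.analyticOrderAt_ne_zero]

/-- An analytic arc in Harvey's surface through the origin has its velocity there on
the `z₃`-axis. -/
theorem deriv_eq_zero_of_eventually_mem_harveySurface {g : ℂ → Fin 4 → ℂ}
    (hg : ∀ i, AnalyticAt ℂ (fun t => g t i) 0) (h0 : g 0 = 0)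
    (hX : ∀ᶠ t in 𝓝 0, g t ∈ harveySurface) {i : Fin 4} (hi : i ≠ 2) :
    deriv (fun t => g t i) 0 = 0 := by
  have hpos (i : Fin 4) : 1 ≤ analyticOrderAt (fun t => g t i) 0 := by
    rw [Order.one_le_iff_ne_zero, (hg i).analyticOrderAt_ne_zero, h0]; rfl
  -- Let a, b, c, d be the vanishing orders of the four coordinates, all at least 1. The equations
  -- of X give 2b = 3a and 2d = a + 2c. The first excludes a = 1 and b = 1; then a ≥ 2 and c ≥ 1
  -- give d ≥ 2.
  have e1 : 2 * analyticOrderAt (fun t => g t 1) 0 = 3 * analyticOrderAt (fun t => g t 0) 0 := by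
    have := analyticOrderAt_congr (f := (fun t => g t 1) ^ 2) (g := (fun t => g t 0) ^ 3)
      (hX.mono fun t ht => (mem_harveySurface_iff.1 ht).1)
    rw [analyticOrderAt_pow (hg 1), analyticOrderAt_pow (hg 0)] at this
    simpa using this
  have e2 : 2 * analyticOrderAt (fun t => g t 3) 0 =
      analyticOrderAt (fun t => g t 0) 0 + 2 * analyticOrderAt (fun t => g t 2) 0 := by
    have := analyticOrderAt_congr (f := (fun t => g t 3) ^ 2)
      (g := (fun t => g t 0) * (fun t => g t 2) ^ 2)
      (hX.mono fun t ht => (mem_harveySurface_iff.1 ht).2.2)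
    rw [analyticOrderAt_pow (hg 3), analyticOrderAt_mul (hg 0) ((hg 2).pow 2),
      analyticOrderAt_pow (hg 2)] at this
    simpa using this
  rw [← two_le_analyticOrderAt_iff_deriv_eq_zero (hg i) (congrFun h0 i)]
  have p0 := hpos 0
  have p1 := hpos 1
  have p2 := hpos 2
  have p3 := hpos 3
  have hmul (c : ℕ) (hc : c ≠ 0) : (c : ℕ∞) * ⊤ = ⊤ := ENat.mul_top (by exact_mod_cast hc)
  have key0 : 2 ≤ analyticOrderAt (fun t => g t 0) 0 := by
    generalize analyticOrderAt (fun t => g t 0) 0 = a at *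
    generalize analyticOrderAt (fun t => g t 1) 0 = b at *
    induction a using ENat.recTopCoe with
    | top => exact le_top
    | coe a =>
      induction b using ENat.recTopCoe with
      | top => exact absurd (e1.symm.trans (hmul 2 two_ne_zero)) (by exact_mod_cast ENat.natCast_ne_top _)
      | coe b => norm_cast at *; omega
  have key1 : 2 ≤ analyticOrderAt (fun t => g t 1) 0 := by
    generalize analyticOrderAt (fun t => g t 0) 0 = a at *
    generalize analyticOrderAt (fun t => g t 1) 0 = b at *
    induction b using ENat.recTopCoe with
    | top => exact le_top
    | coe b =>
      induction a using ENat.recTopCoe with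
      | top => exact absurd (e1.trans (hmul 3 three_ne_zero)) (by exact_mod_cast ENat.natCast_ne_top _)
      | coe a => norm_cast at *; omega
  have key3 : 2 ≤ analyticOrderAt (fun t => g t 3) 0 := by
    generalize analyticOrderAt (fun t => g t 0) 0 = a at *
    generalize analyticOrderAt (fun t => g t 3) 0 = b at *
    generalize analyticOrderAt (fun t => g t 2) 0 = c at *
    have h4 : (2 : ℕ∞) + 2 * 1 ≤ 2 * b := by
      rw [e2]; gcongr
    induction b using ENat.recTopCoe with
    | top => exact le_top
    | coe b => norm_cast at *; omega
  fin_cases i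
  exacts [key0, key1, absurd rfl hi, key3]

theorem not_injective_of_forall_apply_eq_zero (T : (Fin 2 → ℂ) →ₗ[ℂ] Fin 4 → ℂ) (k : Fin 4)
    (hT : ∀ u j, j ≠ k → T u j = 0) : ¬ Function.Injective T := by
  intro h
  have : Function.Injective ((LinearMap.proj k : (Fin 4 → ℂ) →ₗ[ℂ] ℂ).comp T) := by
    intro u v huv
    refine h (funext fun j => ?_)
    by_cases hj : j = k
    · rw [hj]; exact huv
    · rw [hT u j hj, hT v j hj]
  have := LinearMap.finrank_le_finrank_of_injective this
  simp at this

/-- If d ≥ 2, the inverse chart maps a 2-plane into X, and its differential is injective on that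
plane; but arcs in X through 0 have velocity in a single line. If d ≤ 1, the chart flattens X into a
line near 0, which contradicts that f is an immersion at nearby points. -/
theorem not_isRegularPoint_harveySurface_zero (d : ℕ) : ¬ IsRegularPoint harveySurface d 0 := by
  rintro ⟨-, hd, e, h0, he, he', hX⟩
  have hc0 : ∀ i : Fin 4, d ≤ (i : ℕ) → e 0 i = 0 := (hX 0 h0).1 zero_mem_harveySurface
  by_cases h2 : 2 ≤ d
  · have hes : AnalyticAt ℂ e.symm (e 0) := he' _ (e.map_source h0)
    let ι : (Fin 2 → ℂ) →ₗ[ℂ] Fin 4 → ℂ :=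
      LinearMap.pi ![LinearMap.proj 0, LinearMap.proj 1, 0, 0]
    have hι0 (u) : ι u 0 = u 0 := rfl
    have hι1 (u) : ι u 1 = u 1 := rfl
    have hι (u) (i : Fin 4) (hi : d ≤ (i : ℕ)) : ι u i = 0 := by
      have : 2 ≤ (i : ℕ) := h2.trans hi
      fin_cases i
      · simp at this
      · simp at this
      · rfl
      · rfl
    refine not_injective_of_forall_apply_eq_zero
      ((fderiv ℂ e.symm (e 0) : (Fin 4 → ℂ) →ₗ[ℂ] Fin 4 → ℂ).comp ι) 2 (fun u j hj => ?_) ?_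
    · have hl : HasDerivAt (fun t : ℂ => e 0 + t • ι u) (ι u) 0 := by
        simpa using ((hasDerivAt_id (0 : ℂ)).smul_const (ι u)).const_add (e 0)
      have hes0 : AnalyticAt ℂ e.symm (e 0 + (0 : ℂ) • ι u) := by simpa using hes
      have hla : AnalyticAt ℂ (fun t : ℂ => e 0 + t • ι u) 0 := by fun_prop
      have hG : AnalyticAt ℂ (fun t : ℂ => e.symm (e 0 + t • ι u)) 0 :=
        AnalyticAt.comp (f := fun t : ℂ => e 0 + t • ι u) hes0 hla
      have hGi (i : Fin 4) := (analyticAt_pi_iff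
        (f := fun i (t : ℂ) => e.symm (e 0 + t • ι u) i)).1 hG i
      have hder := deriv_eq_zero_of_eventually_mem_harveySurface
        (g := fun t => e.symm (e 0 + t • ι u)) hGi (by simp [e.left_inv h0]) ?_ hj
      · have h3 := hes0.differentiableAt.hasFDerivAt.comp_hasDerivAt (0 : ℂ) hl
        rw [hasDerivAt_pi] at h3
        have h4 := (h3 j).deriv
        simp only [zero_smul, add_zero] at h4
        exact h4.symm.trans hder
      · have : ∀ᶠ t : ℂ in 𝓝 0, e 0 + t • ι u ∈ e.target :=
          hla.continuousAt.eventually_mem (e.open_target.mem_nhds (by simpa using e.map_source h0))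
        filter_upwards [this] with t ht
        rw [hX _ (e.map_target ht), e.right_inv ht]
        intro i hi
        simp [hc0 i hi, hι u i hi]
    · have hid : (fderiv ℂ e 0).comp (fderiv ℂ e.symm (e 0)) = ContinuousLinearMap.id ℂ _ := by
        have h1 : HasFDerivAt e (fderiv ℂ e 0) (e.symm (e 0)) := by
          rw [e.left_inv h0]; exact (he 0 h0).differentiableAt.hasFDerivAt
        refine (h1.comp (e 0) hes.differentiableAt.hasFDerivAt).unique ?_
        refine (hasFDerivAt_id _).congr_of_eventuallyEq ?_
        filter_upwards [e.open_target.mem_nhds (e.map_source h0)] with w hw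
        exact e.right_inv hw
      intro u v huv
      have h1 : fderiv ℂ e.symm (e 0) (ι u) = fderiv ℂ e.symm (e 0) (ι v) := huv
      have h2 := congrArg (fderiv ℂ e 0) h1
      have h3 (w) : fderiv ℂ e 0 (fderiv ℂ e.symm (e 0) w) = w := DFunLike.congr_fun hid w
      rw [h3, h3] at h2
      ext i; fin_cases i
      · exact congrFun h2 0
      · exact congrFun h2 1
  · have hs : ∀ᶠ p in 𝓝 (0 : Fin 2 → ℂ), harveyMap p ∈ e.source :=
      continuous_harveyMap.continuousAt.eventually_mem
        (by rw [harveyMap_zero]; exact e.open_source.mem_nhds h0)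
    -- The rank must be tested off the origin: at 0 itself df has rank 1, which would not contradict
    -- d = 1.
    have : ∃ p : Fin 2 → ℂ, p ≠ 0 ∧ ∀ᶠ p in 𝓝 p, harveyMap p ∈ e.source :=
      ((eventually_mem_nhdsWithin (a := (0 : Fin 2 → ℂ)) (s := {0}ᶜ)).and
        (nhdsWithin_le_nhds hs.eventually_nhds)).exists
    obtain ⟨p, hp0, hp⟩ := this
    have hps := hp.self_of_nhds
    have hde := (he _ hps).differentiableAt.hasFDerivAt
    have hcomp := hde.comp p (harveyMap_analyticAt p).differentiableAt.hasFDerivAt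
    refine not_injective_of_forall_apply_eq_zero
      ((fderiv ℂ e (harveyMap p)).comp (fderiv ℂ harveyMap p) : (Fin 2 → ℂ) →L[ℂ] Fin 4 → ℂ) 0
      (fun u j hj => ?_) ?_
    · have h3 := (hasFDerivAt_pi'.1 hcomp) j
      have h4 : HasFDerivAt (fun q => (e ∘ harveyMap) q j) (0 : (Fin 2 → ℂ) →L[ℂ] ℂ) p := by
        refine (hasFDerivAt_const (0 : ℂ) p).congr_of_eventuallyEq ?_
        filter_upwards [hp] with q hq
        refine (hX _ hq).1 (mem_range_self q) j ?_
        have : (j : ℕ) ≠ 0 := fun h => hj (Fin.ext h)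
        omega
      exact DFunLike.congr_fun (h3.unique h4) u
    · have hid : (fderiv ℂ e.symm (e (harveyMap p))).comp (fderiv ℂ e (harveyMap p)) =
          ContinuousLinearMap.id ℂ _ := by
        have h1 := (he' _ (e.map_source hps)).differentiableAt.hasFDerivAt
        refine (h1.comp (harveyMap p) hde).unique ?_
        refine (hasFDerivAt_id _).congr_of_eventuallyEq ?_
        filter_upwards [e.open_source.mem_nhds hps] with w hw
        exact e.left_inv hw
      intro u v huv
      have h1 : fderiv ℂ e (harveyMap p) (fderiv ℂ harveyMap p u) =
        fderiv ℂ e (harveyMap p) (fderiv ℂ harveyMap p v) := huv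
      have h2 := congrArg (fderiv ℂ e.symm (e (harveyMap p))) h1
      have h3 (w) : fderiv ℂ e.symm (e (harveyMap p)) (fderiv ℂ e (harveyMap p) w) = w :=
        DFunLike.congr_fun hid w
      rw [h3, h3] at h2
      exact fderiv_harveyMap_injective hp0 h2

/-! ## Holomorphic functions on Harvey's surface and hulls -/

theorem HolomorphicOnSet.continuousOn {V : Type*} [NormedAddCommGroup V] [NormedSpace ℂ V]
    {S : Set V} {h : V → ℂ} (hh : HolomorphicOnSet S h) : ContinuousOn h S := fun p hp =>
  let ⟨_, hF, hhF⟩ := hh p hp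
  hF.continuousAt.continuousWithinAt.congr_of_eventuallyEq hhF (hhF.self_of_nhdsWithin hp)

theorem AnalyticOnNhd.holomorphicOnSet {V : Type*} [NormedAddCommGroup V] [NormedSpace ℂ V]
    {S : Set V} {h : V → ℂ} (hh : AnalyticOnNhd ℂ h S) : HolomorphicOnSet S h :=
  fun p hp => ⟨h, hh p hp, EventuallyEq.rfl⟩

theorem holomorphicOnSet_coord {n : ℕ} (S : Set (Fin n → ℂ)) (i : Fin n) :
    HolomorphicOnSet S fun z => z i :=
  AnalyticOnNhd.holomorphicOnSet fun p _ => analyticAt_coord i p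

/-- The competing functions are continuous only on D, so closedness of D is what makes each
inequality a closed condition in the ambient space. -/
theorem isClosed_holomorphicHull {V : Type*} [NormedAddCommGroup V] [NormedSpace ℂ V]
    {D : Set V} (hD : IsClosed D) (K : Set V) : IsClosed (holomorphicHull D K) := by
  refine isClosed_of_closure_subset fun p hp => ⟨?_, fun h hh M hM => ?_⟩
  · exact closure_minimal (fun q hq => hq.1) hD hp
  · have hcl : IsClosed (D ∩ (fun q => ‖h q‖) ⁻¹' Iic M) :=
      hh.continuousOn.norm.preimage_isClosed_of_isClosed hD isClosed_Iic
    have hsub : holomorphicHull D K ⊆ D ∩ (fun q => ‖h q‖) ⁻¹' Iic M :=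
      fun q hq => ⟨hq.1, hq.2 h hh M hM⟩
    exact (closure_minimal hsub hcl hp).2

theorem isBounded_holomorphicHull {n : ℕ} (D : Set (Fin n → ℂ)) {K : Set (Fin n → ℂ)}
    (hK : Bornology.IsBounded K) : Bornology.IsBounded (holomorphicHull D K) := by
  obtain ⟨r, hr, hKr⟩ := hK.exists_pos_norm_le
  refine isBounded_iff_forall_norm_le.2 ⟨r, fun p hp => ?_⟩
  refine (pi_norm_le_iff_of_nonneg hr.le).2 fun i => ?_
  exact hp.2 _ (holomorphicOnSet_coord D i) r fun q hq => (norm_le_pi_norm q i).trans (hKr q hq)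

/-- Closed subsets of `ℂⁿ` are Stein as soon as they carry the restricted structure sheaf. -/
theorem IsClosed.isSteinSet {n : ℕ} {D : Set (Fin n → ℂ)} (hD : IsClosed D) : IsSteinSet D := by
  refine ⟨fun K _ hK => ?_, fun p _ q _ hpq => ?_⟩
  · exact Metric.isCompact_of_isClosed_isBounded (isClosed_holomorphicHull hD K)
      (isBounded_holomorphicHull D hK.isBounded)
  · obtain ⟨i, hi⟩ := Function.ne_iff.1 hpq
    exact ⟨_, holomorphicOnSet_coord D i, hi⟩

theorem HolomorphicOnSet.analyticAt_comp_harveyMap {S : Set (Fin 4 → ℂ)} {h : (Fin 4 → ℂ) → ℂ}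
    (hh : HolomorphicOnSet S h) {q : Fin 2 → ℂ} (hq : harveyMap ⁻¹' S ∈ 𝓝 q) :
    AnalyticAt ℂ (h ∘ harveyMap) q := by
  obtain ⟨F, hF, hhF⟩ := hh _ (show harveyMap q ∈ S from mem_preimage.1 (mem_of_mem_nhds hq))
  refine (hF.comp (harveyMap_analyticAt q)).congr ?_
  have : Tendsto harveyMap (𝓝 q) (𝓝[S] harveyMap q) :=
    tendsto_nhdsWithin_iff.2 ⟨continuous_harveyMap.continuousAt, hq⟩
  filter_upwards [this.eventually hhF] with p hp using hp.symm

theorem analyticAt_vecCons₂ (c w : ℂ) : AnalyticAt ℂ (fun w : ℂ => (![c, w] : Fin 2 → ℂ)) w := by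
  refine (analyticAt_pi_iff (f := fun k w => (![c, w] : Fin 2 → ℂ) k)).2 fun k => ?_
  fin_cases k
  exacts [analyticAt_const, analyticAt_id]

/-- Discs whose boundary is mapped to `K` are mapped to the hull of `K`. -/
theorem harveyMap_mem_holomorphicHull {S K : Set (Fin 4 → ℂ)} {c : ℂ}
    (hS : ∀ w : ℂ, ‖w‖ ≤ 1 → harveyMap ⁻¹' S ∈ 𝓝 ![c, w])
    (hK : ∀ w : ℂ, ‖w‖ = 1 → harveyMap ![c, w] ∈ K) {w : ℂ} (hw : ‖w‖ ≤ 1) :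
    harveyMap ![c, w] ∈ holomorphicHull S K := by
  refine ⟨mem_preimage.1 (mem_of_mem_nhds (hS w hw)), fun h hh M hM => ?_⟩
  have ha (w : ℂ) (hw : ‖w‖ ≤ 1) : AnalyticAt ℂ (fun w : ℂ => h (harveyMap ![c, w])) w :=
    AnalyticAt.comp (g := h ∘ harveyMap) (f := fun w : ℂ => ![c, w])
      (hh.analyticAt_comp_harveyMap (hS w hw)) (analyticAt_vecCons₂ c w)
  have hcl : closure (Metric.ball (0 : ℂ) 1) = Metric.closedBall 0 1 :=
    closure_ball 0 one_ne_zero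
  refine Complex.norm_le_of_forall_mem_frontier_norm_le (f := fun w : ℂ => h (harveyMap ![c, w]))
    (U := Metric.ball 0 1) Metric.isBounded_ball ?_ ?_ ?_
  · refine DifferentiableOn.diffContOnCl fun w hw => ?_
    rw [hcl] at hw
    exact (ha w (by simpa using hw)).differentiableAt.differentiableWithinAt
  · intro w hw
    rw [frontier_ball 0 one_ne_zero] at hw
    exact hM _ (hK w (by simpa using hw))
  · rw [hcl]
    simpa using hw

/-! ## Irreducibility -/

/-- The identity theorem on the parameter side: the interior of f⁻¹(B) is relatively closed in W.
Near a limit point in W, the pulled-back equations of B vanish on an open part of a small ball,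
hence on the whole ball. -/
theorem IsAnalyticSubset.preimage_harveyMap_eq {W : Set (Fin 2 → ℂ)} (hW : IsOpen W)
    (hWc : IsPreconnected W) {B : Set (Fin 4 → ℂ)} (hB : IsAnalyticSubset (harveyMap '' W) B)
    {q : Fin 2 → ℂ} (hq : q ∈ W) (hBq : harveyMap ⁻¹' B ∈ 𝓝 q) : harveyMap '' W ⊆ B := by
  have hsub : W ⊆ interior (harveyMap ⁻¹' B) := by
    refine hWc.subset_of_closure_inter_subset isOpen_interior
      ⟨q, hq, mem_interior_iff_mem_nhds.2 hBq⟩ ?_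
    rintro p ⟨hp, hpW⟩
    obtain ⟨U, hU, hpU, k, F, hF, hUB⟩ := hB.2 (harveyMap p) (mem_image_of_mem _ hpW)
    obtain ⟨r, hr, hball⟩ := Metric.isOpen_iff.1 (hW.inter (hU.preimage continuous_harveyMap)) p
      ⟨hpW, hpU⟩
    obtain ⟨x, hx, hxp⟩ := Metric.mem_closure_iff.1 hp r hr
    have hxb : x ∈ Metric.ball p r := by rwa [Metric.mem_ball']
    refine mem_interior.2 ⟨Metric.ball p r, fun y hy => ?_, Metric.isOpen_ball,
      Metric.mem_ball_self hr⟩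
    refine (hUB _ ⟨(hball hy).2, mem_image_of_mem _ (hball hy).1⟩).2 fun i => ?_
    have han : AnalyticOnNhd ℂ (F i ∘ harveyMap) (Metric.ball p r) := fun z hz =>
      (hF i _ (hball hz).2).comp (harveyMap_analyticAt z)
    refine han.eqOn_zero_of_preconnected_of_eventuallyEq_zero
      (convex_ball p r).isPreconnected hxb ?_ hy
    filter_upwards [mem_interior_iff_mem_nhds.1 hx, Metric.isOpen_ball.mem_nhds hxb] with z hz hzb
    exact (hUB _ ⟨(hball hzb).2, mem_image_of_mem _ (hball hzb).1⟩).1 hz i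
  rintro _ ⟨p, hp, rfl⟩
  exact mem_preimage.1 (interior_subset (hsub hp))

theorem isIrreducibleAnalytic_image_harveyMap {W : Set (Fin 2 → ℂ)} (hW : IsOpen W)
    (hWc : IsConnected W) : IsIrreducibleAnalytic (harveyMap '' W) (harveyMap '' W) := by
  refine ⟨⟨Subset.rfl, fun p _ => ⟨univ, isOpen_univ, mem_univ _, 0, Fin.elim0,
    fun i => i.elim0, fun q hq => ⟨fun _ i => i.elim0, fun _ => hq.2⟩⟩⟩,
    hWc.nonempty.image _, fun B C hB hC hBC => ?_⟩
  by_cases h : harveyMap '' W ⊆ B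
  · exact Or.inl (h.antisymm hB.1)
  · obtain ⟨_, ⟨q, hq, rfl⟩, hqB⟩ := not_subset.1 h
    refine Or.inr ((hC.preimage_harveyMap_eq hW hWc.isPreconnected hq ?_).antisymm hC.1)
    -- Some equation of B is nonzero at f(q), hence near it, so C must contain the image of a
    -- neighbourhood of q.
    obtain ⟨U, hU, hqU, k, F, hF, hUB⟩ := hB.2 (harveyMap q) (mem_image_of_mem _ hq)
    have : ¬ ∀ i, F i (harveyMap q) = 0 := fun h =>
      hqB ((hUB _ ⟨hqU, mem_image_of_mem _ hq⟩).2 h)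
    obtain ⟨i, hi⟩ := not_forall.1 this
    have hFc : ContinuousAt (F i ∘ harveyMap) q :=
      ((hF i _ hqU).comp (harveyMap_analyticAt q)).continuousAt
    filter_upwards [hFc.eventually_ne hi, hW.mem_nhds hq,
      (hU.preimage continuous_harveyMap).mem_nhds hqU] with p hp hpW hpU
    have hpBC : harveyMap p ∈ B ∪ C := hBC ▸ mem_image_of_mem _ hpW
    exact hpBC.resolve_left fun hpB => hp ((hUB _ ⟨hpU, mem_image_of_mem _ hpW⟩).1 hpB i)

theorem isIrreducibleAnalytic_harveySurface :
    IsIrreducibleAnalytic harveySurface harveySurface := by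
  have := isIrreducibleAnalytic_image_harveyMap isOpen_univ isConnected_univ
  rwa [image_univ] at this

/-! ## The compact sets `K` -/

theorem mem_closure_openBidisc {p : Fin 2 → ℂ} :
    p ∈ closure (openBidisc 1) ↔ ‖p 0‖ ≤ 1 ∧ ‖p 1‖ ≤ 1 := by
  have : openBidisc 1 = Metric.ball 0 1 := by
    ext p
    rw [mem_ball_zero_iff, pi_norm_lt_iff one_pos, Fin.forall_fin_two]
    rfl
  rw [this, closure_ball _ one_ne_zero, mem_closedBall_zero_iff,
    pi_norm_le_iff_of_nonneg zero_le_one, Fin.forall_fin_two]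

theorem isOpen_openTube (ε : ℝ) : IsOpen (openTube ε) :=
  isOpen_lt (by fun_prop) continuous_const

theorem isCompact_harveyL (ε : ℝ) : IsCompact (harveyL ε) := by
  refine IsCompact.diff ?_ (isOpen_openTube ε)
  refine Metric.isCompact_of_isClosed_isBounded isClosed_closure ?_
  refine isBounded_iff_forall_norm_le.2 ⟨1, fun p hp => ?_⟩
  rw [pi_norm_le_iff_of_nonneg zero_le_one, Fin.forall_fin_two]
  exact mem_closure_openBidisc.1 hp

theorem isCompact_harveyK (ε : ℝ) : IsCompact (harveyK ε) :=
  (isCompact_harveyL ε).image continuous_harveyMap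

theorem zero_notMem_harveyK {ε : ℝ} (hε : 0 < ε) : 0 ∉ harveyK ε := by
  rintro ⟨p, hp, h⟩
  rw [harveyMap_eq_zero_iff] at h
  refine hp.2 ?_
  rw [h]
  change (0 : ℂ).im ^ 2 + ‖(0 : ℂ)‖ ^ 2 < ε ^ 2
  simp [hε]

theorem harveySurface_diff_harveyK (ε : ℝ) :
    harveySurface \ harveyK ε = harveyMap '' (harveyL ε)ᶜ := by
  rw [compl_eq_univ_sdiff, image_sdiff harveyMap_injective, image_univ]
  rfl

theorem isConnected_setOf_one_lt_norm : IsConnected {z : ℂ | 1 < ‖z‖} := by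
  have : {z : ℂ | 1 < ‖z‖} = Complex.exp '' {z | 0 < z.re} := by
    ext z
    constructor
    · intro hz
      have hz' : (1 : ℝ) < ‖z‖ := hz
      have h0 : z ≠ 0 := norm_pos_iff.1 (one_pos.trans hz')
      refine ⟨Complex.log z, ?_, Complex.exp_log h0⟩
      change 0 < (Complex.log z).re
      rw [Complex.log_re]
      exact Real.log_pos hz'
    · rintro ⟨w, hw, rfl⟩
      change 1 < ‖Complex.exp w‖
      rw [Complex.norm_exp]
      exact Real.one_lt_exp_iff.2 hw
  rw [this]
  refine IsConnected.image ⟨⟨1, by simp⟩, ?_⟩ _ Complex.continuous_exp.continuousOn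
  exact (convex_halfSpace_re_gt 0).isPreconnected

/-- The complement is the union of {|z| > 1}, {|w| > 1} and the tube. The tube is star-shaped and
contains (2, 0), so it is joined to the outside; a small ball in its place would be a separate
bounded component. -/
theorem isConnected_compl_harveyL {ε : ℝ} (hε : 0 < ε) : IsConnected (harveyL ε)ᶜ := by
  have hE : IsConnected {z : ℂ | 1 < ‖z‖} := isConnected_setOf_one_lt_norm
  have hv : Continuous fun z : ℂ × ℂ => (![z.1, z.2] : Fin 2 → ℂ) := by
    refine continuous_pi fun i => ?_
    fin_cases i
    exacts [continuous_fst, continuous_snd]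
  have hA : IsConnected {p : Fin 2 → ℂ | 1 < ‖p 0‖} := by
    have := (hE.prod (isConnected_univ (α := ℂ))).image _ hv.continuousOn
    convert this
    ext p
    constructor
    · intro hp
      refine ⟨(p 0, p 1), ⟨hp, mem_univ _⟩, ?_⟩
      ext i; fin_cases i <;> rfl
    · rintro ⟨z, hz, rfl⟩
      exact hz.1
  have hB : IsConnected {p : Fin 2 → ℂ | 1 < ‖p 1‖} := by
    have := ((isConnected_univ (α := ℂ)).prod hE).image _ hv.continuousOn
    convert this
    ext p
    constructor
    · intro hp
      refine ⟨(p 0, p 1), ⟨mem_univ _, hp⟩, ?_⟩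
      ext i; fin_cases i <;> rfl
    · rintro ⟨z, hz, rfl⟩
      exact hz.2
  have hT : IsConnected (openTube ε) := by
    have h0 : (0 : Fin 2 → ℂ) ∈ openTube ε := by
      change (0 : ℂ).im ^ 2 + ‖(0 : ℂ)‖ ^ 2 < ε ^ 2
      simp [hε]
    refine (StarConvex.isPathConnected (a := 0) (fun p hp s t hs ht hst => ?_) h0).isConnected
    have hp : (p 0).im ^ 2 + ‖p 1‖ ^ 2 < ε ^ 2 := hp
    rw [smul_zero, zero_add]
    change (t • p 0).im ^ 2 + ‖t • p 1‖ ^ 2 < ε ^ 2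
    rw [Complex.smul_im, norm_smul, Real.norm_of_nonneg ht, smul_eq_mul]
    have : t ^ 2 ≤ 1 := pow_le_one₀ ht (by linarith)
    nlinarith [sq_nonneg (p 0).im, sq_nonneg ‖p 1‖]
  have hAT : ({p : Fin 2 → ℂ | 1 < ‖p 0‖} ∩ openTube ε).Nonempty := by
    refine ⟨![2, 0], ?_, ?_⟩
    · simp
    · change (2 : ℂ).im ^ 2 + ‖(0 : ℂ)‖ ^ 2 < ε ^ 2
      simp [hε]
  have hAB : ({p : Fin 2 → ℂ | 1 < ‖p 0‖} ∩ {p | 1 < ‖p 1‖}).Nonempty :=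
    ⟨![2, 2], by simp, by simp⟩
  have hU := (hA.union hAB hB).union (t := openTube ε)
    (hAT.mono (inter_subset_inter_left _ subset_union_left)) hT
  convert hU
  ext p
  simp only [harveyL, mem_compl_iff, Set.mem_sdiff, mem_closure_openBidisc, mem_union, mem_ofPred_eq,
    ← not_le]
  tauto

theorem not_isRelativelyCompactIn_of_isBranch {ε : ℝ} (hε : 0 < ε) {A : Set (Fin 4 → ℂ)}
    (hA : IsBranch (harveySurface \ harveyK ε) A) : ¬ IsRelativelyCompactIn harveySurface A := by
  have hirr := isIrreducibleAnalytic_image_harveyMap (isCompact_harveyL ε).isClosed.isOpen_compl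
    (isConnected_compl_harveyL hε)
  rw [← harveySurface_diff_harveyK] at hirr
  -- X ∖ K is itself irreducible, so maximality leaves only one branch, and that one is unbounded
  -- along the y-axis.
  have hle : harveySurface \ harveyK ε ⊆ A := hA.2 hirr hA.1.1.1
  rintro ⟨C, hC, -, hAC⟩
  obtain ⟨r, hr, hCr⟩ := hC.isBounded.exists_pos_norm_le
  have hmem : harveyMap ![0, ((r + 2 : ℝ) : ℂ)] ∈ harveySurface \ harveyK ε := by
    rw [harveySurface_diff_harveyK]
    refine mem_image_of_mem _ fun h => ?_
    have h1 : ‖((r + 2 : ℝ) : ℂ)‖ ≤ 1 := (mem_closure_openBidisc.1 h.1).2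
    rw [Complex.norm_real, Real.norm_of_nonneg (by positivity)] at h1
    linarith
  have h2 := (norm_le_pi_norm _ 2).trans (hCr _ (hAC (hle hmem)))
  have h3 : ‖((r + 2 : ℝ) : ℂ)‖ ≤ r := h2
  rw [Complex.norm_real, Real.norm_of_nonneg (by positivity)] at h3
  linarith

/-! ### Discs with boundary in K -/

theorem mem_harveyL_of_norm_eq_one {ε : ℝ} (hε : 0 < ε) (hε1 : ε < 1) {c w : ℂ} (hc : ‖c‖ ≤ 1)
    (hw : ‖w‖ = 1) : ![c, w] ∈ harveyL ε := by
  refine ⟨mem_closure_openBidisc.2 ⟨hc, hw.le⟩, fun h => ?_⟩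
  have h : c.im ^ 2 + ‖w‖ ^ 2 < ε ^ 2 := h
  rw [hw] at h
  nlinarith [sq_nonneg c.im]

/-- The starting disc of the sliding family: at z = i the imaginary part alone exceeds ε. -/
theorem mem_harveyL_of_norm_le_one {ε : ℝ} (hε : 0 < ε) (hε1 : ε < 1) {w : ℂ}
    (hw : ‖w‖ ≤ 1) : ![Complex.I, w] ∈ harveyL ε := by
  refine ⟨mem_closure_openBidisc.2 ⟨by simp, hw⟩, fun h => ?_⟩
  have h : Complex.I.im ^ 2 + ‖w‖ ^ 2 < ε ^ 2 := h
  rw [Complex.I_im] at h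
  nlinarith [sq_nonneg ‖w‖]

theorem vecCons_zero_zero : (![(0 : ℂ), 0] : Fin 2 → ℂ) = 0 := by
  ext i; fin_cases i <;> rfl

theorem zero_mem_holomorphicHull {ε : ℝ} (hε : 0 < ε) (hε1 : ε < 1) :
    0 ∈ holomorphicHull harveySurface (harveyK ε) := by
  have := harveyMap_mem_holomorphicHull (S := harveySurface) (K := harveyK ε) (c := 0)
    (fun w _ => Filter.univ_mem' fun p => mem_range_self p)
    (fun w hw => mem_image_of_mem _ (mem_harveyL_of_norm_eq_one hε hε1 (by simp) hw))
    (w := 0) (by simp)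
  rwa [vecCons_zero_zero, harveyMap_zero] at this

theorem continuous_disc : Continuous fun x : ℝ × ℂ =>
    (![((1 - x.1 : ℝ) : ℂ) * Complex.I, x.2] : Fin 2 → ℂ) := by
  refine continuous_pi fun i => ?_
  fin_cases i
  · simp; fun_prop
  · exact continuous_snd

theorem norm_ofReal_one_sub_mul_I_le {t : ℝ} (h0 : 0 ≤ t) (h1 : t ≤ 1) :
    ‖((1 - t : ℝ) : ℂ) * Complex.I‖ ≤ 1 := by
  rw [norm_mul, Complex.norm_I, mul_one, Complex.norm_real, Real.norm_of_nonneg (by linarith)]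
  linarith

/-- A continuity principle: a family of discs that starts in `U` and whose members lie in the
closed set `H ⊆ U` as soon as they lie in `U` stays in `H`. -/
theorem forall_mem_of_discs {X : Type*} [TopologicalSpace X] {Φ : ℝ × ℂ → X} (hΦ : Continuous Φ)
    {H U : Set X} (hH : IsClosed H) (hU : IsOpen U) (hHU : H ⊆ U)
    (h0 : ∀ w : ℂ, ‖w‖ ≤ 1 → Φ (0, w) ∈ U)
    (hstep : ∀ t : ℝ, 0 ≤ t → t ≤ 1 → (∀ w : ℂ, ‖w‖ ≤ 1 → Φ (t, w) ∈ U) →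
      ∀ w : ℂ, ‖w‖ ≤ 1 → Φ (t, w) ∈ H) {t : ℝ} (ht : t ∈ Icc (0 : ℝ) 1) {w : ℂ} (hw : ‖w‖ ≤ 1) :
    Φ (t, w) ∈ H := by
  have hZ : IsClosed {t : ℝ | ∀ w : ℂ, ‖w‖ ≤ 1 → Φ (t, w) ∈ H} := by
    have : {t : ℝ | ∀ w : ℂ, ‖w‖ ≤ 1 → Φ (t, w) ∈ H} =
        ⋂ (w : ℂ) (_ : ‖w‖ ≤ 1), (fun t => Φ (t, w)) ⁻¹' H := by
      ext t; simp
    rw [this]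
    exact isClosed_iInter fun w => isClosed_iInter fun _ =>
      hH.preimage (hΦ.comp (f := fun t : ℝ => (t, w)) (by fun_prop))
  have hsub : Icc (0 : ℝ) 1 ⊆ {t : ℝ | ∀ w : ℂ, ‖w‖ ≤ 1 → Φ (t, w) ∈ H} := by
    refine (hZ.inter isClosed_Icc).Icc_subset_of_forall_mem_nhdsWithin
      (hstep 0 le_rfl zero_le_one h0) ?_
    rintro t ⟨ht, ht0, ht1⟩
    have htube : ({t} : Set ℝ) ×ˢ Metric.closedBall (0 : ℂ) 1 ⊆ Φ ⁻¹' U := by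
      rintro ⟨s, w⟩ ⟨hs, hw⟩
      have hs : s = t := hs
      rw [hs]
      exact hHU (ht w (by simpa using hw))
    -- By compactness of the disc, the members for nearby parameters still lie in U, and `hstep`
    -- returns them to H.
    obtain ⟨u, v, hu, -, htu, hv, huv⟩ := generalized_tube_lemma isCompact_singleton
      (isCompact_closedBall (0 : ℂ) 1) (hU.preimage hΦ) htube
    filter_upwards [nhdsWithin_le_nhds (hu.mem_nhds (htu rfl)), Ioo_mem_nhdsGT ht1] with s hs hs1
    exact hstep s (ht0.trans hs1.1.le) hs1.2.le fun w hw =>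
      huv (mk_mem_prod hs (hv (by simpa using hw)))
  exact hsub ht w hw

/-- Every Stein neighbourhood of `K` contains the origin: push the discs `{(is, w) : |w| ≤ 1}`
from `s = 1` to `s = 0`. -/
theorem zero_mem_of_isSteinSet {ε : ℝ} (hε : 0 < ε) (hε1 : ε < 1) {U : Set (Fin 4 → ℂ)}
    (hU : IsOpen U) (hKU : harveyK ε ⊆ U) (hS : IsSteinSet (harveySurface ∩ U)) : 0 ∈ U := by
  have hKX : harveyK ε ⊆ harveySurface := image_subset_range _ _
  -- Holomorphic convexity enters here: the hull is compact, hence closed in ℂ⁴ although X ∩ U need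
  -- not be.
  have hHc := (hS.1 _ (subset_inter hKX hKU) (isCompact_harveyK ε)).isClosed
  have hHU : holomorphicHull (harveySurface ∩ U) (harveyK ε) ⊆ U := fun p hp => hp.1.2
  have hnhds (q : Fin 2 → ℂ) (hq : harveyMap q ∈ U) :
      harveyMap ⁻¹' (harveySurface ∩ U) ∈ 𝓝 q := by
    filter_upwards [(hU.preimage continuous_harveyMap).mem_nhds hq] with p hp
    exact ⟨mem_range_self p, hp⟩
  have h := forall_mem_of_discs (continuous_harveyMap.comp continuous_disc) hHc hU hHU
    (fun w hw => ?_) (fun t h0 h1 h w hw => ?_) (right_mem_Icc.2 zero_le_one) (w := 0) (by simp)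
  · have h2 : harveyMap ![((1 - 1 : ℝ) : ℂ) * Complex.I, 0] = 0 := by
      rw [sub_self, Complex.ofReal_zero, zero_mul, vecCons_zero_zero, harveyMap_zero]
    exact h2 ▸ hHU h
  · have h2 : ((1 - 0 : ℝ) : ℂ) * Complex.I = Complex.I := by simp
    refine hKU (mem_image_of_mem harveyMap ?_)
    change ![((1 - 0 : ℝ) : ℂ) * Complex.I, w] ∈ harveyL ε
    rw [h2]
    exact mem_harveyL_of_norm_le_one hε hε1 hw
  · have hc := norm_ofReal_one_sub_mul_I_le h0 h1
    have h2 (w : ℂ) (hw : ‖w‖ ≤ 1) : harveyMap ![((1 - t : ℝ) : ℂ) * Complex.I, w] ∈ U := h w hw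
    change harveyMap ![((1 - t : ℝ) : ℂ) * Complex.I, w] ∈ _
    generalize ((1 - t : ℝ) : ℂ) * Complex.I = c at hc h2 ⊢
    exact harveyMap_mem_holomorphicHull (fun w hw => hnhds _ (h2 w hw))
      (fun w hw => mem_image_of_mem _ (mem_harveyL_of_norm_eq_one hε hε1 hc hw)) hw

/-- The discs over c = (1 - t)i with t < 1 avoid the origin, so a holomorphically convex C would
contain their centres. These tend to 0, which a closed C avoiding 0 does not allow. -/
theorem holomorphicHull_ne {ε : ℝ} (hε : 0 < ε) (hε1 : ε < 1) {C : Set (Fin 4 → ℂ)}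
    (hC : IsCompact C) (hKC : harveyK ε ⊆ C) (hCX : C ⊆ harveySurface \ {0}) :
    holomorphicHull (harveySurface \ {0}) C ≠ C := by
  intro h
  let Φ : ℝ → Fin 4 → ℂ := fun t => harveyMap ![((1 - t : ℝ) : ℂ) * Complex.I, 0]
  have hΦ : Continuous Φ := continuous_harveyMap.comp
    (continuous_disc.comp (f := fun t : ℝ => (t, (0 : ℂ))) (by fun_prop))
  have hmem (t : ℝ) (ht0 : 0 ≤ t) (ht1 : t < 1) : Φ t ∈ C := by
    rw [← h]
    refine harveyMap_mem_holomorphicHull (fun w _ => ?_) (fun w hw => hKC (mem_image_of_mem _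
      (mem_harveyL_of_norm_eq_one hε hε1 (norm_ofReal_one_sub_mul_I_le ht0 ht1.le) hw))) (by simp)
    have hne : (![((1 - t : ℝ) : ℂ) * Complex.I, w] : Fin 2 → ℂ) ≠ 0 := by
      refine ne_zero_iff_fin_two.2 (Or.inl ?_)
      refine mul_ne_zero ?_ Complex.I_ne_zero
      exact_mod_cast (sub_pos.2 ht1).ne'
    filter_upwards [eventually_ne_nhds hne] with p hp
    exact ⟨mem_range_self p, by simpa [harveyMap_eq_zero_iff] using hp⟩
  have h1 : Φ 1 ∈ C := by
    refine hC.isClosed.mem_of_tendsto (b := 𝓝[<] (1 : ℝ))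
      (hΦ.continuousAt.tendsto.mono_left nhdsWithin_le_nhds) ?_
    filter_upwards [Ioo_mem_nhdsLT (zero_lt_one (α := ℝ))] with t ht
    exact hmem t ht.1.le ht.2
  have h2 : Φ 1 = 0 := by simp [Φ, vecCons_zero_zero, harveyMap_zero]
  rw [h2] at h1
  exact (hCX h1).2 rfl

/-! ## Homological codimension -/

open Pointwise in
theorem isSMulRegular_quotSMulTop_iff {R : Type*} [CommRing R] {r s : R} :
    IsSMulRegular (QuotSMulTop r R) s ↔ ∀ a b : R, s * a = r * b → ∃ c, a = r * c := by
  have hmem (a : R) : a ∈ r • (⊤ : Submodule R R) ↔ ∃ c, a = r * c := by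
    rw [Submodule.mem_smul_pointwise_iff_exists]
    simp [eq_comm]
  refine (isSMulRegular_quotient_iff_mem_of_smul_mem _ _).trans ?_
  simp only [hmem, smul_eq_mul, forall_exists_index]

/-- The hypothesis makes every s a zero divisor modulo every nonzero r, which rules out a second
term; a first term equal to 0 is never regular on R. -/
theorem codh_le_one {R : Type*} [CommRing R] [IsLocalRing R]
    (h : ∀ r ∈ IsLocalRing.maximalIdeal R, r ≠ 0 → ∀ s ∈ IsLocalRing.maximalIdeal R,
      ∃ a b, s * a = r * b ∧ ∀ c, a ≠ r * c) : codh R R ≤ 1 := by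
  refine iSup₂_le fun rs hrs => ?_
  match rs with
  | [] => simp
  | [_] => simp
  | r :: s :: rs =>
    exfalso
    obtain ⟨hm, hreg⟩ := hrs
    rw [RingTheory.Sequence.isWeaklyRegular_cons_iff,
      RingTheory.Sequence.isWeaklyRegular_cons_iff] at hreg
    have hr0 : r ≠ 0 := by
      rintro rfl
      exact one_ne_zero (hreg.1 (by simp : (0 : R) • (1 : R) = (0 : R) • (0 : R)))
    obtain ⟨a, b, hab, hc⟩ := h r (hm r (by simp)) hr0 s (hm s (by simp))
    obtain ⟨c, hac⟩ := isSMulRegular_quotSMulTop_iff.1 hreg.2.1 a b hab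
    exact hc c hac

theorem one_le_codh {R : Type*} [CommRing R] [IsLocalRing R] {r : R}
    (hr : r ∈ IsLocalRing.maximalIdeal R) (hreg : ∀ a, r * a = 0 → a = 0) : 1 ≤ codh R R := by
  refine le_iSup₂_of_le [r] ⟨by simpa using hr, ?_⟩ (by simp)
  rw [RingTheory.Sequence.isWeaklyRegular_cons_iff]
  exact ⟨isSMulRegular_iff_right_eq_zero_of_smul.2 hreg, .nil _ _⟩

theorem two_le_codh {R : Type*} [CommRing R] [IsLocalRing R] {r s : R}
    (hr : r ∈ IsLocalRing.maximalIdeal R) (hs : s ∈ IsLocalRing.maximalIdeal R)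
    (hreg : ∀ a, r * a = 0 → a = 0) (hrs : ∀ a b, s * a = r * b → ∃ c, a = r * c) :
    2 ≤ codh R R := by
  refine le_iSup₂_of_le [r, s] ⟨by simpa using ⟨hr, hs⟩, ?_⟩ (by simp)
  rw [RingTheory.Sequence.isWeaklyRegular_cons_iff, RingTheory.Sequence.isWeaklyRegular_cons_iff]
  exact ⟨isSMulRegular_iff_right_eq_zero_of_smul.2 hreg, isSMulRegular_quotSMulTop_iff.2 hrs,
    .nil _ _⟩

section stalk

variable {V : Type*} [NormedAddCommGroup V] [NormedSpace ℂ V]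

/-- The germ along `X` of an ambient holomorphic function. -/
def analyticStalk.mk {X : Set V} (p : X) (F : V → ℂ) (hF : AnalyticAt ℂ F p) :
    analyticStalk X p :=
  ⟨(F : Germ (𝓝[X] (p : V)) ℂ), F, hF, rfl⟩

theorem analyticStalk.exists_eq_mk {X : Set V} {p : X} (a : analyticStalk X p) :
    ∃ F hF, a = analyticStalk.mk p F hF := by
  obtain ⟨_, F, hF, rfl⟩ := a
  exact ⟨F, hF, rfl⟩

theorem analyticStalk.mk_mul_mk {X : Set V} {p : X} {F G : V → ℂ} (hF : AnalyticAt ℂ F p)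
    (hG : AnalyticAt ℂ G p) : analyticStalk.mk p F hF * analyticStalk.mk p G hG =
      analyticStalk.mk p (F * G) (hF.mul hG) := rfl

theorem analyticStalk.mk_eq_mk_iff {X : Set V} {p : X} {F G : V → ℂ} (hF : AnalyticAt ℂ F p)
    (hG : AnalyticAt ℂ G p) : analyticStalk.mk p F hF = analyticStalk.mk p G hG ↔
      ∀ᶠ z in 𝓝[X] (p : V), F z = G z := by
  rw [Subtype.ext_iff]
  exact Germ.coe_eq

theorem analyticStalk.mk_eq_zero_iff {X : Set V} {p : X} {F : V → ℂ} (hF : AnalyticAt ℂ F p) :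
    analyticStalk.mk p F hF = 0 ↔ ∀ᶠ z in 𝓝[X] (p : V), F z = 0 :=
  analyticStalk.mk_eq_mk_iff hF analyticAt_const

theorem analyticStalk.mk_mem_maximalIdeal_iff {X : Set V} {p : X} {F : V → ℂ}
    (hF : AnalyticAt ℂ F p) :
    analyticStalk.mk p F hF ∈ IsLocalRing.maximalIdeal (analyticStalk X p) ↔ F p = 0 := by
  rw [IsLocalRing.mem_maximalIdeal, mem_nonunits_iff]
  constructor
  · intro h
    by_contra h0
    exact h (analyticStalk_isUnit X p F hF h0 _ rfl)
  · rintro h0 ⟨u, hu⟩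
    obtain ⟨G, hG, hGu⟩ := analyticStalk.exists_eq_mk (u⁻¹ : (analyticStalk X p)ˣ).val
    have h1 := u.mul_inv
    rw [hu, hGu, analyticStalk.mk_mul_mk] at h1
    have h2 := ((analyticStalk.mk_eq_mk_iff (hF.mul hG) analyticAt_const).1 h1).self_of_nhdsWithin
      p.2
    rw [Pi.mul_apply, h0, zero_mul] at h2
    exact zero_ne_one h2

theorem two_le_stalkCodh {X : Set V} {p : X} {r s : analyticStalk X p}
    (hr : r ∈ IsLocalRing.maximalIdeal (analyticStalk X p))
    (hs : s ∈ IsLocalRing.maximalIdeal (analyticStalk X p))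
    (hreg : ∀ a, r * a = 0 → a = 0) (hrs : ∀ a b, s * a = r * b → ∃ c, a = r * c) :
    2 ≤ stalkCodh X p :=
  two_le_codh hr hs hreg hrs

end stalk

/-- Germs of holomorphic functions form a domain. -/
theorem AnalyticAt.eventually_eq_zero_or_eventually_eq_zero {E : Type*} [NormedAddCommGroup E]
    [NormedSpace ℂ E] {f g : E → ℂ} {x : E} (hf : AnalyticAt ℂ f x) (hg : AnalyticAt ℂ g x)
    (hfg : ∀ᶠ z in 𝓝 x, f z * g z = 0) : (∀ᶠ z in 𝓝 x, f z = 0) ∨ ∀ᶠ z in 𝓝 x, g z = 0 := by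
  obtain ⟨r, hr, hball⟩ := Metric.eventually_nhds_iff_ball.1
    (hf.eventually_analyticAt.and (hg.eventually_analyticAt.and hfg))
  by_cases h : ∀ z ∈ Metric.ball x r, f z = 0
  · exact Or.inl (Metric.eventually_nhds_iff_ball.2 ⟨r, hr, h⟩)
  · push Not at h
    obtain ⟨y, hy, hy0⟩ := h
    refine Or.inr (Metric.eventually_nhds_iff_ball.2 ⟨r, hr, ?_⟩)
    have hga : AnalyticOnNhd ℂ g (Metric.ball x r) := fun z hz => (hball z hz).2.1
    refine hga.eqOn_zero_of_preconnected_of_eventuallyEq_zero (convex_ball x r).isPreconnected hy ?_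
    filter_upwards [(hball y hy).1.continuousAt.eventually_ne hy0,
      Metric.isOpen_ball.mem_nhds hy] with z hz hzb
    exact (mul_eq_zero.1 (hball z hzb).2.2).resolve_left hz

/-- A coordinate has nonzero differential. As germs form a domain, coordinates minus constants can
then be cancelled. -/
theorem not_eventually_coord_sub_eq_zero {n : ℕ} (i : Fin n) (q : Fin n → ℂ) (c : ℂ) :
    ¬ ∀ᶠ p in 𝓝 q, p i - c = 0 := by
  intro h
  have h1 : HasFDerivAt (fun p : Fin n → ℂ => p i - c)
      (ContinuousLinearMap.proj (R := ℂ) (φ := fun _ : Fin n => ℂ) i) q :=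
    (ContinuousLinearMap.proj (R := ℂ) (φ := fun _ : Fin n => ℂ) i).hasFDerivAt.sub_const c
  have h2 := h1.unique ((hasFDerivAt_const (0 : ℂ) q).congr_of_eventuallyEq h)
  have h3 := DFunLike.congr_fun h2 (Pi.single i 1)
  simp at h3

/-- Multiplication by `x` maps the maximal ideal of `𝒪_{X,0}` to `𝒪_{X,0}`. -/
theorem exists_analyticAt_eq_coord_mul {A : (Fin 4 → ℂ) → ℂ} (hA : AnalyticAt ℂ A 0)
    (hA0 : A 0 = 0) : ∃ B : (Fin 4 → ℂ) → ℂ, AnalyticAt ℂ B 0 ∧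
      ∀ᶠ p in 𝓝 (0 : Fin 2 → ℂ), B (harveyMap p) = p 0 * A (harveyMap p) := by
  obtain ⟨g, hg, hgA⟩ := hA.exists_eq_add_clm_apply
  have hgi (i : Fin 4) : AnalyticAt ℂ (fun z => g z (Pi.single i 1)) 0 :=
    (ContinuousLinearMap.apply ℂ ℂ (Pi.single i 1 : Fin 4 → ℂ)).analyticAt _ |>.comp hg
  have hz (i : Fin 4) := analyticAt_coord i (0 : Fin 4 → ℂ)
  -- The coefficients come from x · (x², x³, y, xy) = (x³, x⁴, xy, x²y), whose entries are `z 1`, `z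
  -- 0 ^ 2`, `z 3` and `z 0 * z 2` on X.
  refine ⟨fun z => z 1 * g z (Pi.single 0 1) + z 0 ^ 2 * g z (Pi.single 1 1) +
    z 3 * g z (Pi.single 2 1) + z 0 * z 2 * g z (Pi.single 3 1),
    ((((hz 1).mul (hgi 0)).add (((hz 0).pow 2).mul (hgi 1))).add ((hz 3).mul (hgi 2))).add
      (((hz 0).mul (hz 2)).mul (hgi 3)), ?_⟩
  have ht : Tendsto harveyMap (𝓝 0) (𝓝 0) := by
    have := (harveyMap_analyticAt 0).continuousAt.tendsto
    rwa [harveyMap_zero] at this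
  filter_upwards [ht.eventually hgA] with p hp
  have hsum : harveyMap p = p 0 ^ 2 • Pi.single 0 1 + p 0 ^ 3 • Pi.single 1 1 +
      p 1 • Pi.single 2 1 + (p 0 * p 1) • Pi.single 3 1 := by
    ext i; fin_cases i <;> simp
  have h2 : g (harveyMap p) (harveyMap p) = p 0 ^ 2 * g (harveyMap p) (Pi.single 0 1) +
      p 0 ^ 3 * g (harveyMap p) (Pi.single 1 1) + p 1 * g (harveyMap p) (Pi.single 2 1) +
      p 0 * p 1 * g (harveyMap p) (Pi.single 3 1) := by
    conv_lhs => rw [congrArg (g (harveyMap p)) hsum]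
    simp only [map_add, map_smul, smul_eq_mul]
  rw [hp, hA0, h2]
  simp only [harveyMap_apply_zero, harveyMap_apply_one, harveyMap_apply_two,
    harveyMap_apply_three]
  ring

theorem eventually_nhdsWithin_harveySurface_zero {P : (Fin 4 → ℂ) → Prop} :
    (∀ᶠ z in 𝓝[harveySurface] 0, P z) ↔ ∀ᶠ p in 𝓝 0, P (harveyMap p) := by
  rw [← eventually_nhdsWithin_harveySurface, harveyMap_zero]

theorem AnalyticAt.comp_harveyMap_zero {F : (Fin 4 → ℂ) → ℂ} (hF : AnalyticAt ℂ F 0) :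
    AnalyticAt ℂ (fun p => F (harveyMap p)) 0 :=
  AnalyticAt.comp (by rwa [harveyMap_zero]) (harveyMap_analyticAt 0)

/-- For r = A and s = B in the maximal ideal, xA and xB lie in the stalk and B · (xA) = A · (xB). If
xA = A · D with A ≠ 0, cancelling A would give D = x, which no ambient germ satisfies. The germ y
supplies a regular sequence of length one. -/
theorem stalkCodh_harveyOrigin : stalkCodh harveySurface harveyOrigin = 1 := by
  refine le_antisymm (codh_le_one fun r hr hr0 s hs => ?_) ?_
  · obtain ⟨A, hA, rfl⟩ := analyticStalk.exists_eq_mk r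
    obtain ⟨B, hB, rfl⟩ := analyticStalk.exists_eq_mk s
    rw [analyticStalk.mk_mem_maximalIdeal_iff] at hr hs
    obtain ⟨A', hA', hA'A⟩ := exists_analyticAt_eq_coord_mul hA hr
    obtain ⟨B', hB', hB'B⟩ := exists_analyticAt_eq_coord_mul hB hs
    replace hA' : AnalyticAt ℂ A' (harveyOrigin : Fin 4 → ℂ) := hA'
    replace hB' : AnalyticAt ℂ B' (harveyOrigin : Fin 4 → ℂ) := hB'
    refine ⟨analyticStalk.mk _ A' hA', analyticStalk.mk _ B' hB', ?_, fun c hc => ?_⟩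
    · rw [analyticStalk.mk_mul_mk, analyticStalk.mk_mul_mk, analyticStalk.mk_eq_mk_iff]
      refine eventually_nhdsWithin_harveySurface_zero.2 ?_
      filter_upwards [hA'A, hB'B] with p h1 h2
      simp only [Pi.mul_apply, h1, h2]
      ring
    · obtain ⟨D, hD, rfl⟩ := analyticStalk.exists_eq_mk c
      rw [analyticStalk.mk_mul_mk, analyticStalk.mk_eq_mk_iff] at hc
      have hc := eventually_nhdsWithin_harveySurface_zero.1 hc
      have hcoord := analyticAt_coord 0 (0 : Fin 2 → ℂ)
      have hmul : ∀ᶠ p in 𝓝 (0 : Fin 2 → ℂ),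
          A (harveyMap p) * (D (harveyMap p) - p 0) = 0 := by
        filter_upwards [hc, hA'A] with p h1 h2
        rw [h2, Pi.mul_apply] at h1
        linear_combination -h1
      rcases hA.comp_harveyMap_zero.eventually_eq_zero_or_eventually_eq_zero
        (hD.comp_harveyMap_zero.sub hcoord) hmul with h | h
      · exact hr0 ((analyticStalk.mk_eq_zero_iff hA).2
          (eventually_nhdsWithin_harveySurface_zero.2 h))
      · have ht : Tendsto (fun x : ℂ => (![x, 0] : Fin 2 → ℂ)) (𝓝 0) (𝓝 0) := by
          have : Continuous fun x : ℂ => (![x, 0] : Fin 2 → ℂ) := by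
            refine continuous_pi fun i => ?_
            fin_cases i <;> simp <;> fun_prop
          exact this.tendsto' _ _ vecCons_zero_zero
        refine not_eventually_eq_coord hD (nhdsWithin_le_nhds ?_)
        filter_upwards [ht.eventually h] with x hx
        exact sub_eq_zero.1 hx
  · have h2 : AnalyticAt ℂ (fun z : Fin 4 → ℂ => z 2) (harveyOrigin : Fin 4 → ℂ) :=
      analyticAt_coord 2 _
    refine one_le_codh (r := analyticStalk.mk harveyOrigin _ h2)
      ((analyticStalk.mk_mem_maximalIdeal_iff h2).2 rfl) fun a ha => ?_
    obtain ⟨A, hA, rfl⟩ := analyticStalk.exists_eq_mk a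
    rw [analyticStalk.mk_mul_mk, analyticStalk.mk_eq_zero_iff] at ha
    have ha := eventually_nhdsWithin_harveySurface_zero.1 ha
    refine (analyticStalk.mk_eq_zero_iff hA).2 (eventually_nhdsWithin_harveySurface_zero.2 ?_)
    refine ((analyticAt_coord 1 (0 : Fin 2 → ℂ)).eventually_eq_zero_or_eventually_eq_zero
      hA.comp_harveyMap_zero ha).resolve_left fun h => ?_
    refine not_eventually_coord_sub_eq_zero (1 : Fin 2) 0 0 ?_
    simpa using h

/-- Division by a coordinate: if `(x - q₀) A = (y - q₁) B` near `q`, then `y - q₁` divides `A`. -/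
theorem exists_eq_coord_sub_mul {A B : (Fin 2 → ℂ) → ℂ} {q : Fin 2 → ℂ} (hA : AnalyticAt ℂ A q)
    (hAB : ∀ᶠ p in 𝓝 q, (p 0 - q 0) * A p = (p 1 - q 1) * B p) :
    ∃ C : (Fin 2 → ℂ) → ℂ, AnalyticAt ℂ C q ∧ ∀ᶠ p in 𝓝 q, A p = (p 1 - q 1) * C p := by
  have hq0 : (0 : Fin 2 → ℂ) + q = q := zero_add q
  have hta : AnalyticAt ℂ (fun u : Fin 2 → ℂ => u + q) 0 := analyticAt_id.add analyticAt_const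
  have htt : Tendsto (fun u : Fin 2 → ℂ => u + q) (𝓝 0) (𝓝 q) := by
    simpa using hta.continuousAt.tendsto
  have hsa : AnalyticAt ℂ (fun p : Fin 2 → ℂ => p - q) q := analyticAt_id.sub analyticAt_const
  have hst : Tendsto (fun p : Fin 2 → ℂ => p - q) (𝓝 q) (𝓝 0) := by
    simpa using hsa.continuousAt.tendsto
  have hT : AnalyticAt ℂ (fun u => A (u + q)) 0 :=
    AnalyticAt.comp (g := A) (by rwa [hq0]) hta
  have hPa : AnalyticAt ℂ (fun u : Fin 2 → ℂ => (![u 0, 0] : Fin 2 → ℂ)) 0 := by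
    refine (analyticAt_pi_iff (f := fun k (u : Fin 2 → ℂ) =>
      (![u 0, 0] : Fin 2 → ℂ) k)).2 fun k => ?_
    fin_cases k
    exacts [analyticAt_coord 0 _, analyticAt_const]
  have hP0 : (![(0 : Fin 2 → ℂ) 0, 0] : Fin 2 → ℂ) = 0 := vecCons_zero_zero
  have hPt : Tendsto (fun u : Fin 2 → ℂ => (![u 0, 0] : Fin 2 → ℂ)) (𝓝 0) (𝓝 0) := by
    have := hPa.continuousAt.tendsto
    rwa [hP0] at this
  have hTP : AnalyticAt ℂ (fun u : Fin 2 → ℂ => A (![u 0, 0] + q)) 0 :=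
    AnalyticAt.comp (g := fun u => A (u + q)) (f := fun u : Fin 2 → ℂ => ![u 0, 0])
      (by rwa [hP0]) hPa
  -- On the line y = q₁ the hypothesis reads (x - q₀) A = 0; cancelling the first factor shows that
  -- A vanishes there.
  have hvan := ((analyticAt_coord 0 (0 : Fin 2 → ℂ)).eventually_eq_zero_or_eventually_eq_zero hTP
    (by filter_upwards [hPt.eventually (htt.eventually hAB)] with u hu using by simpa using hu)
    ).resolve_left fun h => not_eventually_coord_sub_eq_zero (0 : Fin 2) 0 0 (by simpa using h)
  obtain ⟨C, hC, hTC⟩ := hT.exists_eq_mul_of_eventually_eq_zero hvan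
  refine ⟨fun p => C (p - q), AnalyticAt.comp (g := C) (by rwa [sub_self]) hsa, ?_⟩
  filter_upwards [hst.eventually hTC] with p hp
  simpa using hp

/-- The local left inverse ψ supplies ambient representatives of y - q₁ and x - q₀, which form a
regular sequence as in ℂ². A quotient C found on ℂ² returns to the stalk as C ∘ ψ. -/
theorem two_le_stalkCodh_of_ne_zero {p : harveySurface} (hp : (p : Fin 4 → ℂ) ≠ 0) :
    2 ≤ stalkCodh harveySurface p := by
  obtain ⟨q, rfl⟩ : ∃ q, p = ⟨harveyMap q, mem_range_self q⟩ :=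
    let ⟨q, hq⟩ := p.2
    ⟨q, Subtype.ext hq.symm⟩
  have hq0 : q ≠ 0 := fun h => hp (by simp [h, harveyMap_zero])
  obtain ⟨ψ, hψ, hψq⟩ := exists_analyticAt_leftInverse hq0
  have hψi (i : Fin 2) : AnalyticAt ℂ (fun z => ψ z i - q i) (harveyMap q) :=
    ((analyticAt_pi_iff (f := fun i z => ψ z i)).1 hψ i).sub analyticAt_const
  have hψq0 : ψ (harveyMap q) = q := hψq.self_of_nhds
  have hcomp {F : (Fin 4 → ℂ) → ℂ} (hF : AnalyticAt ℂ F (harveyMap q)) :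
      AnalyticAt ℂ (fun p => F (harveyMap p)) q := hF.comp (harveyMap_analyticAt q)
  refine two_le_stalkCodh (r := analyticStalk.mk _ _ (hψi 1))
    (s := analyticStalk.mk _ _ (hψi 0))
    ((analyticStalk.mk_mem_maximalIdeal_iff _).2 (by simp [hψq0]))
    ((analyticStalk.mk_mem_maximalIdeal_iff _).2 (by simp [hψq0])) (fun a ha => ?_)
    (fun a b hab => ?_)
  · obtain ⟨A, hA, rfl⟩ := analyticStalk.exists_eq_mk a
    rw [analyticStalk.mk_mul_mk, analyticStalk.mk_eq_zero_iff] at ha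
    have ha := eventually_nhdsWithin_harveySurface.1 ha
    refine (analyticStalk.mk_eq_zero_iff hA).2 (eventually_nhdsWithin_harveySurface.2 ?_)
    refine ((hcomp (hψi 1)).eventually_eq_zero_or_eventually_eq_zero
      (hcomp hA) ha).resolve_left fun h => not_eventually_coord_sub_eq_zero 1 q (q 1) ?_
    filter_upwards [h, hψq] with p h1 h2
    rwa [h2] at h1
  · obtain ⟨A, hA, rfl⟩ := analyticStalk.exists_eq_mk a
    obtain ⟨B, hB, rfl⟩ := analyticStalk.exists_eq_mk b
    rw [analyticStalk.mk_mul_mk, analyticStalk.mk_mul_mk, analyticStalk.mk_eq_mk_iff] at hab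
    have hab := eventually_nhdsWithin_harveySurface.1 hab
    obtain ⟨C, hC, hAC⟩ := exists_eq_coord_sub_mul (B := fun p => B (harveyMap p)) (hcomp hA) (by
      filter_upwards [hab, hψq] with p h1 h2
      simpa [h2] using h1)
    have hCψ : AnalyticAt ℂ (fun z => C (ψ z)) (harveyMap q) :=
      AnalyticAt.comp (g := C) (by rwa [hψq0]) hψ
    refine ⟨analyticStalk.mk _ _ hCψ, ?_⟩
    rw [analyticStalk.mk_mul_mk, analyticStalk.mk_eq_mk_iff]
    refine eventually_nhdsWithin_harveySurface.2 ?_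
    filter_upwards [hAC, hψq] with p h1 h2
    simp only [Pi.mul_apply, h2, h1]

theorem mainTheorem10 :
    -- the parametrization `f` is injective, proper, with `f⁻¹(0) = 0`, immersive exactly off `0`
    (Function.Injective harveyMap ∧ IsProperMap harveyMap ∧ harveyMap ⁻¹' {0} = {0} ∧
      AnalyticOnNhd ℂ harveyMap univ ∧
      (fderiv ℂ harveyMap 0).rank = 1 ∧ ∀ p, p ≠ 0 → (fderiv ℂ harveyMap p).rank = 2) ∧
    -- `X` is an irreducible Stein analytic surface in `ℂ⁴` with an isolated singularity at `0`
    (IsAnalyticSubset univ harveySurface ∧ IsSteinSet harveySurface ∧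
      IsIrreducibleAnalytic harveySurface harveySurface ∧
      (∀ p ∈ harveySurface \ {0}, IsRegularPoint harveySurface 2 p) ∧
      ∀ d : ℕ, ¬ IsRegularPoint harveySurface d 0) ∧
    -- the function `x` is holomorphic on `X ∖ {0}` and does not extend across `0`
    ((∀ p, p ≠ 0 → harveyFunction (harveyMap p) = p 0) ∧
      (∀ z ∈ harveySurface, z 2 ≠ 0 → harveyFunction z = z 3 / z 2) ∧
      HolomorphicOnSet (harveySurface \ {0}) harveyFunction ∧
      ∀ U : Set (Fin 4 → ℂ), IsOpen U → 0 ∈ U →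
        ¬ ∃ G : (Fin 4 → ℂ) → ℂ, HolomorphicOnSet (harveySurface ∩ U) G ∧
          EqOn G harveyFunction ((harveySurface ∩ U) \ {0})) ∧
    -- homological codimension at `0`
    stalkCodh harveySurface harveyOrigin = 1 ∧
    -- the compact sets `K`: the hypotheses of the extension theorem in its weak form hold,
    -- but `codh ≥ 2` fails on the hull of `K` and on every Stein neighbourhood of `K`
    ∀ ε : ℝ, 0 < ε → ε < 1 →
      IsCompact (harveyK ε) ∧ 0 ∉ harveyK ε ∧
      IsConnected (harveySurface \ harveyK ε) ∧
      (∀ A, IsBranch (harveySurface \ harveyK ε) A → ¬ IsRelativelyCompactIn harveySurface A) ∧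
      (∀ p : harveySurface, (p : Fin 4 → ℂ) ∈ harveyK ε → 2 ≤ stalkCodh harveySurface p) ∧
      0 ∈ holomorphicHull harveySurface (harveyK ε) ∧
      (∀ U : Set (Fin 4 → ℂ), IsOpen U → harveyK ε ⊆ U → IsSteinSet (harveySurface ∩ U) →
        0 ∈ U) ∧
      (∀ C : Set (Fin 4 → ℂ), IsCompact C → harveyK ε ⊆ C → C ⊆ harveySurface \ {0} →
        holomorphicHull (harveySurface \ {0}) C ≠ C) := by
  refine ⟨⟨harveyMap_injective, isProperMap_harveyMap, ?_, fun p _ => harveyMap_analyticAt p,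
    rank_fderiv_harveyMap_zero, fun p hp => rank_fderiv_harveyMap_of_ne_zero hp⟩,
    ⟨isAnalyticSubset_harveySurface, isClosed_harveySurface.isSteinSet,
      isIrreducibleAnalytic_harveySurface, fun p hp => isRegularPoint_harveySurface hp,
      not_isRegularPoint_harveySurface_zero⟩,
    ⟨fun p _ => harveyFunction_harveyMap p, fun z hz h2 => harveyFunction_eq_of_ne_zero hz h2,
      holomorphicOnSet_harveyFunction, fun U hU h0 => harveyFunction_not_extends hU h0⟩,
    stalkCodh_harveyOrigin, fun ε hε hε1 => ⟨isCompact_harveyK ε, zero_notMem_harveyK hε, ?_,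
      fun A hA => not_isRelativelyCompactIn_of_isBranch hε hA, fun p hp =>
        two_le_stalkCodh_of_ne_zero fun h => zero_notMem_harveyK hε (h ▸ hp),
      zero_mem_holomorphicHull hε hε1, fun U hU hKU hS => zero_mem_of_isSteinSet hε hε1 hU hKU hS,
      fun C hC hKC hCX => holomorphicHull_ne hε hε1 hC hKC hCX⟩⟩
  · ext p
    simp [harveyMap_eq_zero_iff]
  · rw [harveySurface_diff_harveyK]
    exact (isConnected_compl_harveyL hε).image _ continuous_harveyMap.continuousOn
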